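/- Let $r=\sqrt{\sec(\pi/6)}$. The hexagon system has as state space $\Omega\subset\mathbb R^3$ the convex hull of $\omega_i=(r\cos\frac{2\pi i}{6},\,r\sin\frac{2\pi i}{6},\,1)^{\mathrm T}$, $i=1,\dots,6$; its effects are the $e\in\mathbb R^3$ with $0\le e^{\mathrm T}\omega\le 1$ for all $\omega\in\Omega$, and its unit effect is $u=(0,0,1)^{\mathrm T}$. Its reversible transformations are $$T_k^s=\begin{pmatrix}\cos\frac{2\pi k}{6}&-s\sin\frac{2\pi k}{6}&0\\ \sin\frac{2\pi k}{6}&s\cos\frac{2\pi k}{6}&0\\0&0&1\end{pmatrix},\qquad k\in\{1,\dots,6\},\ s=\pm1 .$$ Write elements of $\mathbb R^3\otimes\mathbb R^3$ as $3\times3$ matrices, $a\otimes b\leftrightarrow ab^{\mathrm T}$, so that $(e\otimes f)(\Phi)=e^{\mathrm T}\Phi f$. The states of the maximal tensor product of two hexagon systems are the matrices $\Phi$ with $e^{\mathrm T}\Phi f\ge0$ for all effects $e,f$ and $u^{\mathrm T}\Phi u=1$. A state is entangled if it is not a convex combination of product states $\omega\omega'^{\mathrm T}$ with $\omega,\omega'\in\Omega$;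 an extreme entangled state is an extreme point of the set of states of the maximal tensor product that is entangled. Two matrices $\Phi,\Psi$ are called equivalent under local reversible transformations if $\Psi=S\Phi T^{\mathrm T}$ for some reversible transformations $S,T$ (the swap of the two parties is not included). A state $\Phi$ is symmetric if $(e\otimes f)(\Phi)=(f\otimes e)(\Phi)$ for all $e,f\in\mathbb R^3$ that are nonnegative on $\Omega$. Put $$\Phi_I=\begin{pmatrix}\cos\frac{\pi}{6}&\sin\frac{\pi}{6}&0\\-\sin\frac{\pi}{6}&\cos\frac{\pi}{6}&0\\0&0&1\end{pmatrix},\quad \Phi_{II}=\begin{pmatrix}\frac{1}{15r^2}&\frac{7}{10}&\frac{2}{3r^3}\\\frac{7}{10}&\frac{1}{5r^2}&\frac{3}{5r}\\\frac{2}{3r^3}&\frac{3}{5r}&1\end{pmatrix},\quad \Phi_{III}=\begin{pmatrix}\frac{1}{3r^2}&\frac{1}{r^4}&\frac{2}{3r^3}\\\frac{1}{r^4}&0&\frac{1}{2r}\\\frac{2}{3r^3}&\frac{1}{2r}&1\end{pmatrix},$$ $$\Phi_{IV}=\begin{pmatrix}\frac{1}{7r^2}&\frac{9}{14}&\frac{10}{21r^3}\\\frac{11}{14}&\frac{1}{7r^2}&\frac{5}{7r}\\\frac{6}{7r^3}&\frac{3}{7r}&1\end{pmatrix},\quad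 \Phi_{V}=\begin{pmatrix}\frac{1}{7r^2}&\frac{11}{14}&\frac{6}{7r^3}\\\frac{9}{14}&\frac{1}{7r^2}&\frac{3}{7r}\\\frac{10}{21r^3}&\frac{5}{7r}&1\end{pmatrix},\quad \Phi_{VI}=\begin{pmatrix}\frac{-1}{2r^2}&\frac{-1}{r^4}&\frac{1}{3r^3}\\\frac{-1}{r^4}&\frac{1}{2r^2}&\frac{-1}{2r}\\\frac{1}{3r^3}&\frac{-1}{2r}&1\end{pmatrix}.$$ Then equivalence under local reversible transformations is an equivalence relation, and it divides the extreme entangled states into exactly six classes, with representatives $\Phi_I,\dots,\Phi_{VI}$: each of these six matrices is an extreme entangled state, no two of them are equivalent, and a matrix is an extreme entangled state if and only if it is equivalent to one of them. The state $\Phi_I$ is Janotta's maximally entangled state of two $n$-gons for $n=6$, which for even $n$ is $$\Phi_J=\begin{pmatrix}\cos\frac{\pi}{n}&\sin\frac{\pi}{n}&0\\-\sin\frac{\pi}{n}&\cos\frac{\pi}{n}&0\\0&0&1\end{pmatrix}.$$ The states $\Phi_{II},\Phi_{III},\Phi_{VI}$ are symmetric; $\Phi_I,\Phi_{IV},\Phi_V$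 are not. Moreover, the matrix $\Phi_{III}'$ obtained from $\Phi_{III}$ by changing the sign of all entries of its first two columns is equivalent to $\Phi_{III}$, so it represents the same class. -/

import Mathlib

open Matrix

noncomputable section

/-- The circumradius `r_n = √(sec (π / n))` of the `n`-gon state space. -/
def polygonRadius (n : ℕ) : ℝ := Real.sqrt (1 / Real.cos (Real.pi / n))

/-- The pure states `ω_i` of the `n`-gon system. -/
def pureState (n i : ℕ) : Fin 3 → ℝ :=
  ![polygonRadius n * Real.cos (2 * Real.pi * i / n),
    polygonRadius n * Real.sin (2 * Real.pi * i / n),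
    1]

/-- The normalized state space `Ω_n`: the regular polygon with vertices `ω_1, …, ω_n`. -/
def stateSpace (n : ℕ) : Set (Fin 3 → ℝ) :=
  convexHull ℝ {ω | ∃ i : ℕ, 1 ≤ i ∧ i ≤ n ∧ ω = pureState n i}

/-- The unit effect `u`. -/
def unitEffect : Fin 3 → ℝ := ![0, 0, 1]

/-- The effect space: all `e` with `0 ≤ e(ω) ≤ 1` on every state, where `e(ω) = eᵀ ω`. -/
def effectSpace (n : ℕ) : Set (Fin 3 → ℝ) :=
  {e | ∀ ω ∈ stateSpace n, 0 ≤ e ⬝ᵥ ω ∧ e ⬝ᵥ ω ≤ 1}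

/-- The cone of unnormalized effects. -/
def effectCone (n : ℕ) : Set (Fin 3 → ℝ) :=
  {e | ∀ ω ∈ stateSpace n, 0 ≤ e ⬝ᵥ ω}

/-- The value `(e ⊗ f)(Φ)` of a product effect on an element of `ℝ³ ⊗ ℝ³`, the latter being
written as a `3 × 3` matrix, with `a ⊗ b` corresponding to `a bᵀ`. -/
def prodEffect (e f : Fin 3 → ℝ) (Φ : Matrix (Fin 3) (Fin 3) ℝ) : ℝ := e ⬝ᵥ (Φ *ᵥ f)

/-- The normalized states of the maximal tensor product of two `n`-gon systems. -/
def maxTensor (n : ℕ) : Set (Matrix (Fin 3) (Fin 3) ℝ) :=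
  {Φ | (∀ e ∈ effectSpace n, ∀ f ∈ effectSpace n, 0 ≤ prodEffect e f Φ) ∧
    prodEffect unitEffect unitEffect Φ = 1}

/-- The normalized states of the minimal tensor product: mixtures of product states. -/
def minTensor (n : ℕ) : Set (Matrix (Fin 3) (Fin 3) ℝ) :=
  convexHull ℝ {Φ | ∃ a ∈ stateSpace n, ∃ b ∈ stateSpace n, Φ = vecMulVec a b}

/-- The extreme entangled states of the maximal tensor product of two `n`-gon systems. -/
def extremeEntangled (n : ℕ) : Set (Matrix (Fin 3) (Fin 3) ℝ) :=
  {Φ | Φ ∈ (maxTensor n).extremePoints ℝ ∧ Φ ∉ minTensor n}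

/-- The transformation `T_k^s` of the `n`-gon: a rotation for `s = 1`,
a reflection for `s = -1`. -/
def polygonTransformation (n k : ℕ) (s : ℝ) : Matrix (Fin 3) (Fin 3) ℝ :=
  !![Real.cos (2 * Real.pi * k / n), -s * Real.sin (2 * Real.pi * k / n), 0;
     Real.sin (2 * Real.pi * k / n), s * Real.cos (2 * Real.pi * k / n), 0;
     0, 0, 1]

/-- The reversible transformations of the `n`-gon: `n` rotations and `n` reflections. -/
def reversibleTransformations (n : ℕ) : Set (Matrix (Fin 3) (Fin 3) ℝ) :=
  {T | ∃ k : ℕ, ∃ s : ℝ, 1 ≤ k ∧ k ≤ n ∧ (s = 1 ∨ s = -1) ∧ T = polygonTransformation n k s}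

/-- The action of `S ⊗ T` on `ℝ³ ⊗ ℝ³` in matrix form; it sends `a bᵀ` to `(S a) (T b)ᵀ`. -/
def localAction (S T Φ : Matrix (Fin 3) (Fin 3) ℝ) : Matrix (Fin 3) (Fin 3) ℝ := S * Φ * Tᵀ

/-- Two bipartite states are equivalent if a local reversible transformation maps one to
the other. The swap of the two parties is not a local transformation. -/
def LocallyEquivalent (n : ℕ) (Φ Ψ : Matrix (Fin 3) (Fin 3) ℝ) : Prop :=
  ∃ S ∈ reversibleTransformations n, ∃ T ∈ reversibleTransformations n, Ψ = localAction S T Φ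

/-- The set of equivalence classes of extreme entangled states. -/
def entanglementClasses (n : ℕ) : Set (Set (Matrix (Fin 3) (Fin 3) ℝ)) :=
  {C | ∃ Φ ∈ extremeEntangled n, C = {Ψ | Ψ ∈ extremeEntangled n ∧ LocallyEquivalent n Φ Ψ}}

/-- A bipartite state is symmetric if `(e ⊗ f)(Φ) = (f ⊗ e)(Φ)` for all `e, f` in the
effect cone. -/
def IsSymmetricState (n : ℕ) (Φ : Matrix (Fin 3) (Fin 3) ℝ) : Prop :=
  ∀ e ∈ effectCone n, ∀ f ∈ effectCone n, prodEffect e f Φ = prodEffect f e Φ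

/-- Janotta's maximally entangled state of two `n`-gons. -/
def janottaState (n : ℕ) : Matrix (Fin 3) (Fin 3) ℝ :=
  if Even n then
    !![Real.cos (Real.pi / n), Real.sin (Real.pi / n), 0;
       -Real.sin (Real.pi / n), Real.cos (Real.pi / n), 0;
       0, 0, 1]
  else 1

def hexPhiI : Matrix (Fin 3) (Fin 3) ℝ :=
  !![Real.cos (Real.pi / 6), Real.sin (Real.pi / 6), 0;
     -Real.sin (Real.pi / 6), Real.cos (Real.pi / 6), 0;
     0, 0, 1]

def hexPhiII : Matrix (Fin 3) (Fin 3) ℝ :=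
  let r := polygonRadius 6
  !![1 / (15 * r ^ 2), 7 / 10, 2 / (3 * r ^ 3);
     7 / 10, 1 / (5 * r ^ 2), 3 / (5 * r);
     2 / (3 * r ^ 3), 3 / (5 * r), 1]

def hexPhiIII : Matrix (Fin 3) (Fin 3) ℝ :=
  let r := polygonRadius 6
  !![1 / (3 * r ^ 2), 1 / r ^ 4, 2 / (3 * r ^ 3);
     1 / r ^ 4, 0, 1 / (2 * r);
     2 / (3 * r ^ 3), 1 / (2 * r), 1]

/-- The image of `hexPhiIII` under the rotation by `π` on the second side: the first two
columns change sign. It is another representative of the class of `hexPhiIII`. -/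
def hexPhiIII' : Matrix (Fin 3) (Fin 3) ℝ :=
  let r := polygonRadius 6
  !![-1 / (3 * r ^ 2), -1 / r ^ 4, 2 / (3 * r ^ 3);
     -1 / r ^ 4, 0, 1 / (2 * r);
     -2 / (3 * r ^ 3), -1 / (2 * r), 1]

def hexPhiIV : Matrix (Fin 3) (Fin 3) ℝ :=
  let r := polygonRadius 6
  !![1 / (7 * r ^ 2), 9 / 14, 10 / (21 * r ^ 3);
     11 / 14, 1 / (7 * r ^ 2), 5 / (7 * r);
     6 / (7 * r ^ 3), 3 / (7 * r), 1]

def hexPhiV : Matrix (Fin 3) (Fin 3) ℝ :=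
  let r := polygonRadius 6
  !![1 / (7 * r ^ 2), 11 / 14, 6 / (7 * r ^ 3);
     9 / 14, 1 / (7 * r ^ 2), 3 / (7 * r);
     10 / (21 * r ^ 3), 5 / (7 * r), 1]

def hexPhiVI : Matrix (Fin 3) (Fin 3) ℝ :=
  let r := polygonRadius 6
  !![-1 / (2 * r ^ 2), -1 / r ^ 4, 1 / (3 * r ^ 3);
     -1 / r ^ 4, 1 / (2 * r ^ 2), -1 / (2 * r);
     1 / (3 * r ^ 3), -1 / (2 * r), 1]

/-- The six representatives `Φ_I, …, Φ_VI`. -/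
def hexPhi : Fin 6 → Matrix (Fin 3) (Fin 3) ℝ :=
  ![hexPhiI, hexPhiII, hexPhiIII, hexPhiIV, hexPhiV, hexPhiVI]

end

/-! The effect cone of the hexagon is generated by six extreme effects, indexed mod 6. A matrix is
therefore a state of the maximal tensor product iff its 36 values on pairs of extreme effects are
nonnegative and its last entry is 1 (`mem_maxTensor_iff`). These states form a slice of a polyhedral
cone in a space of dimension nine, and the effects with indices 0, 2, 4 form a basis, so nine of the
values determine the matrix. A state is an extreme point iff every matrix that vanishes on the same
effect pairs is a multiple of it (`mem_extremePoints_maxTensor_iff`). Local reversible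
transformations permute the table of values, acting on rows and columns by dihedral permutations of
the indices.

Completeness of the list: an extreme state has a zero in its table, and a symmetry moves that zero
to the pair (0, 0). What remains is to find the extreme rays of an eight-dimensional cone with 35
constraints. A double description algorithm on integer data is proved correct
(`HitsAllFaces.ddNext`) and evaluated by the kernel (`ddRun_matchRows`): each ray it returns is
proportional to an image of one of seven tables, those of the six representatives and that of a
product of two vertices. This gives `exists_classRep`. The seventh class is separable, so it drops
out.

Conversely, each representative is extreme because the zeros of its table determine the table up to
a factor (`classTable_unique`). It is entangled because an extreme separable state is a product
state, whose table has rank one, while a 2 by 2 minor of the representative is nonzero.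
Inequivalence is a finite comparison of tables under the 144 local symmetries
(`classTables_not_equivalent`). -/

/-! ### The symmetry group of the hexagon -/

/-- The rotation by `θ` of the first two coordinates (`s = 1`), or that rotation
composed with a reflection (`s = -1`). -/
noncomputable def planarIsometry (θ s : ℝ) : Matrix (Fin 3) (Fin 3) ℝ :=
  !![Real.cos θ, -s * Real.sin θ, 0; Real.sin θ, s * Real.cos θ, 0; 0, 0, 1]

/-- The matrix is a rotation by `θ` after `diag (1, s, 1)`, and moving that diagonal factor past a
rotation by `η` turns it into a rotation by `s * η`. -/
theorem planarIsometry_mul {s : ℝ} (hs : s = 1 ∨ s = -1) (θ η t : ℝ) :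
    planarIsometry θ s * planarIsometry η t = planarIsometry (θ + s * η) (s * t) := by
  rcases hs with rfl | rfl <;> ext i j <;> fin_cases i <;> fin_cases j <;>
    simp [planarIsometry, Matrix.mul_apply, Fin.sum_univ_three, Real.cos_add, Real.sin_add] <;> ring

theorem planarIsometry_zero : planarIsometry 0 1 = 1 := by
  ext i j; fin_cases i <;> fin_cases j <;> simp [planarIsometry]

theorem mem_reversibleTransformations_iff {T : Matrix (Fin 3) (Fin 3) ℝ} :
    T ∈ reversibleTransformations 6 ↔
      ∃ m : ℤ, ∃ s : ℝ, (s = 1 ∨ s = -1) ∧ T = planarIsometry (Real.pi * m / 3) s := by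
  constructor
  · rintro ⟨k, s, -, -, hs, rfl⟩
    refine ⟨k, s, hs, ?_⟩
    have : 2 * Real.pi * k / (6 : ℕ) = Real.pi * (k : ℤ) / 3 := by push_cast; ring
    simp only [polygonTransformation, planarIsometry, this]
  · rintro ⟨m, s, hs, rfl⟩
    -- The transformations are numbered from 1 to 6, so the residue is taken in that range instead
    -- of 0 to 5.
    obtain ⟨k, q, hk, hk', hm⟩ : ∃ k : ℕ, ∃ q : ℤ, 1 ≤ k ∧ k ≤ 6 ∧ m = k + 6 * q :=
      ⟨((m - 1) % 6 + 1).toNat, (m - 1) / 6, by omega, by omega, by omega⟩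
    refine ⟨k, s, hk, hk', hs, ?_⟩
    have : Real.pi * m / 3 = 2 * Real.pi * k / (6 : ℕ) + q * (2 * Real.pi) := by
      rw [hm]; push_cast; ring
    simp only [polygonTransformation, planarIsometry, this, Real.cos_add_int_mul_two_pi,
      Real.sin_add_int_mul_two_pi]

theorem one_mem_reversibleTransformations : (1 : Matrix (Fin 3) (Fin 3) ℝ) ∈
    reversibleTransformations 6 :=
  mem_reversibleTransformations_iff.2 ⟨0, 1, Or.inl rfl, by simp [planarIsometry_zero]⟩

theorem mul_mem_reversibleTransformations {S T : Matrix (Fin 3) (Fin 3) ℝ}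
    (hS : S ∈ reversibleTransformations 6) (hT : T ∈ reversibleTransformations 6) :
    S * T ∈ reversibleTransformations 6 := by
  rw [mem_reversibleTransformations_iff] at *
  obtain ⟨m, s, hs, rfl⟩ := hS
  obtain ⟨l, t, ht, rfl⟩ := hT
  rw [planarIsometry_mul hs]
  rcases hs with rfl | rfl
  · exact ⟨m + l, t, ht, by push_cast; congr 1 <;> ring⟩
  · exact ⟨m - l, -t, by rcases ht with rfl | rfl <;> simp, by push_cast; congr 1 <;> ring⟩

theorem exists_inv_mem_reversibleTransformations {S : Matrix (Fin 3) (Fin 3) ℝ}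
    (hS : S ∈ reversibleTransformations 6) :
    ∃ S' ∈ reversibleTransformations 6, S' * S = 1 ∧ S * S' = 1 := by
  obtain ⟨m, s, hs, rfl⟩ := mem_reversibleTransformations_iff.1 hS
  refine ⟨planarIsometry (Real.pi * (-s * m) / 3) s, mem_reversibleTransformations_iff.2 ?_, ?_, ?_⟩
  · rcases hs with rfl | rfl
    · exact ⟨-m, 1, Or.inl rfl, by push_cast; congr 1; ring⟩
    · exact ⟨m, -1, Or.inr rfl, by congr 1; ring⟩
  all_goals
    rw [planarIsometry_mul hs, ← planarIsometry_zero]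
    congr 1 <;> rcases hs with rfl | rfl <;> ring

theorem localAction_localAction (S T S' T' Φ : Matrix (Fin 3) (Fin 3) ℝ) :
    localAction S T (localAction S' T' Φ) = localAction (S * S') (T * T') Φ := by
  simp only [localAction, Matrix.transpose_mul, Matrix.mul_assoc]

theorem localAction_one (Φ : Matrix (Fin 3) (Fin 3) ℝ) : localAction 1 1 Φ = Φ := by
  simp [localAction]

theorem localAction_smul (S T Φ : Matrix (Fin 3) (Fin 3) ℝ) (c : ℝ) :
    localAction S T (c • Φ) = c • localAction S T Φ := by
  simp [localAction]

theorem locallyEquivalent_equivalence : Equivalence (LocallyEquivalent 6) where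
  refl Φ := ⟨1, one_mem_reversibleTransformations, 1, one_mem_reversibleTransformations,
    (localAction_one Φ).symm⟩
  symm := by
    rintro Φ _ ⟨S, hS, T, hT, rfl⟩
    obtain ⟨S', hS', h1, -⟩ := exists_inv_mem_reversibleTransformations hS
    obtain ⟨T', hT', h2, -⟩ := exists_inv_mem_reversibleTransformations hT
    exact ⟨S', hS', T', hT', by rw [localAction_localAction, h1, h2, localAction_one]⟩
  trans := by
    rintro Φ _ _ ⟨S, hS, T, hT, rfl⟩ ⟨S', hS', T', hT', rfl⟩
    exact ⟨S' * S, mul_mem_reversibleTransformations hS' hS, T' * T,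
      mul_mem_reversibleTransformations hT' hT, localAction_localAction ..⟩

/-! ### The extreme effects of the hexagon -/

theorem polygonRadius_six_pos : 0 < polygonRadius 6 := by
  have : Real.cos (Real.pi / (6 : ℕ)) = √3 / 2 := by push_cast; exact Real.cos_pi_div_six
  rw [polygonRadius, this]; positivity

theorem polygonRadius_six_sq_mul : polygonRadius 6 ^ 2 * √3 = 2 := by
  have : Real.cos (Real.pi / (6 : ℕ)) = √3 / 2 := by push_cast; exact Real.cos_pi_div_six
  rw [polygonRadius, this, Real.sq_sqrt (by positivity)]
  field_simp

theorem polygonRadius_six_mul : polygonRadius 6 * (√3 / 2) = 1 / polygonRadius 6 := by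
  have h := polygonRadius_six_pos
  field_simp
  linarith [polygonRadius_six_sq_mul]

/-- With this relation the surd `√3` disappears: all later arithmetic takes place in powers of the
radius, reduced by its fourth power. -/
theorem polygonRadius_six_pow_four : polygonRadius 6 ^ 4 = 4 / 3 := by
  have h := polygonRadius_six_sq_mul
  have h3 : √(3 : ℝ) ^ 2 = 3 := Real.sq_sqrt (by norm_num)
  have : polygonRadius 6 ^ 4 * √3 ^ 2 = 4 := by
    rw [show polygonRadius 6 ^ 4 * √3 ^ 2 = (polygonRadius 6 ^ 2 * √3) ^ 2 by ring, h]; norm_num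
  rw [h3] at this; linarith

/-- The extreme rays of the effect cone of the hexagon, with period `6` in the index. -/
noncomputable def hexEffect (i : ℤ) : Fin 3 → ℝ :=
  ![-(polygonRadius 6 * Real.sin (Real.pi * i / 3)), polygonRadius 6 * Real.cos (Real.pi * i / 3), 1]

theorem hexEffect_add_six_mul (i q : ℤ) : hexEffect (i + 6 * q) = hexEffect i := by
  have : Real.pi * (i + 6 * q : ℤ) / 3 = Real.pi * i / 3 + q * (2 * Real.pi) := by push_cast; ring
  simp only [hexEffect, this, Real.cos_add_int_mul_two_pi, Real.sin_add_int_mul_two_pi]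

theorem hexEffect_emod_six (i : ℤ) : hexEffect i = hexEffect (i % 6) := by
  conv_lhs => rw [← Int.emod_add_mul_ediv i 6, hexEffect_add_six_mul]

theorem hexEffect_add_three (i : ℤ) : hexEffect (i + 3) = ![- hexEffect i 0, - hexEffect i 1, 1] := by
  have : Real.pi * (i + 3 : ℤ) / 3 = Real.pi * i / 3 + Real.pi := by push_cast; ring
  simp only [hexEffect, this, Real.cos_add_pi, Real.sin_add_pi]
  simp

theorem hexEffect_zero : hexEffect 0 = ![0, polygonRadius 6, 1] := by simp [hexEffect]

theorem hexEffect_one :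
    hexEffect 1 = ![-(1 / polygonRadius 6), polygonRadius 6 / 2, 1] := by
  rw [hexEffect, show Real.pi * (1 : ℤ) / 3 = Real.pi / 3 by push_cast; ring,
    Real.sin_pi_div_three, Real.cos_pi_div_three, polygonRadius_six_mul]
  congr 2; ring_nf

theorem hexEffect_two :
    hexEffect 2 = ![-(1 / polygonRadius 6), -(polygonRadius 6 / 2), 1] := by
  rw [hexEffect, show Real.pi * (2 : ℤ) / 3 = Real.pi - Real.pi / 3 by push_cast; ring,
    Real.sin_pi_sub, Real.cos_pi_sub, Real.sin_pi_div_three, Real.cos_pi_div_three,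
    polygonRadius_six_mul]
  congr 2; ring_nf

theorem hexEffect_three : hexEffect 3 = ![0, -polygonRadius 6, 1] := by
  rw [show (3 : ℤ) = 0 + 3 by rfl, hexEffect_add_three, hexEffect_zero]; simp

theorem hexEffect_four :
    hexEffect 4 = ![1 / polygonRadius 6, -(polygonRadius 6 / 2), 1] := by
  rw [show (4 : ℤ) = 1 + 3 by rfl, hexEffect_add_three, hexEffect_one]; simp

theorem hexEffect_five :
    hexEffect 5 = ![1 / polygonRadius 6, polygonRadius 6 / 2, 1] := by
  rw [show (5 : ℤ) = 2 + 3 by rfl, hexEffect_add_three, hexEffect_two]; simp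

/-- The basis dual to the effects with indices `0`, `2`, `4`. -/
noncomputable def dualState : Fin 3 → Fin 3 → ℝ :=
  ![![0, 2 / (3 * polygonRadius 6), 1 / 3],
    ![-(polygonRadius 6 / 2), -(1 / (3 * polygonRadius 6)), 1 / 3],
    ![polygonRadius 6 / 2, -(1 / (3 * polygonRadius 6)), 1 / 3]]

theorem eq_sum_hexEffect (e : Fin 3 → ℝ) :
    e = (e ⬝ᵥ dualState 0) • hexEffect 0 + (e ⬝ᵥ dualState 1) • hexEffect 2 +
      (e ⬝ᵥ dualState 2) • hexEffect 4 := by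
  have h := polygonRadius_six_pos.ne'
  rw [hexEffect_zero, hexEffect_two, hexEffect_four]
  ext i
  fin_cases i <;> simp [dualState, dotProduct, Fin.sum_univ_three] <;> field_simp <;> ring

/-- The value of the effect with index `i` on the pure state with index `k`, as a function
of `i - k`. -/
theorem hexEffect_dotProduct_pureState (i : ℤ) (k : ℕ) :
    hexEffect i ⬝ᵥ pureState 6 k = hexEffect (i - k) ⬝ᵥ pureState 6 6 := by
  have h : Real.pi * (i - k : ℤ) / 3 = Real.pi * i / 3 - 2 * Real.pi * k / (6 : ℕ) := by
    push_cast; ring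
  have h' : 2 * Real.pi * (6 : ℕ) / (6 : ℕ) = 2 * Real.pi := by push_cast; ring
  simp only [hexEffect, pureState, dotProduct, Fin.sum_univ_three, h, h']
  simp [Real.sin_sub]; ring

theorem pureState_six_six : pureState 6 6 = ![polygonRadius 6, 0, 1] := by
  have h' : 2 * Real.pi * (6 : ℕ) / (6 : ℕ) = 2 * Real.pi := by push_cast; ring
  simp only [pureState, h']; simp

theorem exists_fin_hexEffect (i : ℤ) : ∃ a : Fin 6, hexEffect i = hexEffect a := by
  refine ⟨⟨(i % 6).toNat, by omega⟩, ?_⟩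
  rw [hexEffect_emod_six i]; congr 1; simp; omega

/-- Values of the extreme effects on the last pure state. -/
noncomputable def vertexTable : Fin 6 → ℝ := ![1, 0, 0, 1, 2, 2]

theorem hexEffect_fin_dotProduct (a : Fin 6) :
    hexEffect a ⬝ᵥ pureState 6 6 = vertexTable a := by
  have h := polygonRadius_six_pos.ne'
  rw [pureState_six_six]
  fin_cases a <;>
    simp [vertexTable, hexEffect_zero, hexEffect_one, hexEffect_two, hexEffect_three, hexEffect_four,
      hexEffect_five, dotProduct, Fin.sum_univ_three, h] <;> norm_num

theorem hexEffect_dotProduct_mem_Icc (i : ℤ) {ω : Fin 3 → ℝ} (hω : ω ∈ stateSpace 6) :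
    hexEffect i ⬝ᵥ ω ∈ Set.Icc (0 : ℝ) 2 := by
  have hconv : Convex ℝ {ω : Fin 3 → ℝ | hexEffect i ⬝ᵥ ω ∈ Set.Icc (0 : ℝ) 2} :=
    (convex_Icc (0 : ℝ) 2).is_linear_preimage
      ⟨fun x y => dotProduct_add _ x y, fun c x => dotProduct_smul c _ x⟩
  refine convexHull_min ?_ hconv hω
  rintro _ ⟨k, -, -, rfl⟩
  obtain ⟨a, ha⟩ := exists_fin_hexEffect (i - k)
  simp only [Set.mem_ofPred_eq]
  rw [hexEffect_dotProduct_pureState, ha, hexEffect_fin_dotProduct]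
  fin_cases a <;> simp [vertexTable]

theorem hexEffect_mem_effectCone (i : ℤ) : hexEffect i ∈ effectCone 6 :=
  fun _ hω => (hexEffect_dotProduct_mem_Icc i hω).1

/-- The extreme rays are normalized by last coordinate 1 and reach the value 2 on a vertex, hence
the factor one half. -/
theorem half_hexEffect_mem_effectSpace (i : ℤ) : (1 / 2 : ℝ) • hexEffect i ∈ effectSpace 6 := by
  intro ω hω
  have := hexEffect_dotProduct_mem_Icc i hω
  rw [smul_dotProduct, smul_eq_mul]
  exact ⟨by linarith [this.1], by linarith [this.2]⟩

theorem three_smul_hexEffect :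
    (3 : ℝ) • hexEffect 1 = (2 : ℝ) • hexEffect 0 + (2 : ℝ) • hexEffect 2 - hexEffect 4 ∧
    (3 : ℝ) • hexEffect 3 = (2 : ℝ) • hexEffect 2 + (2 : ℝ) • hexEffect 4 - hexEffect 0 ∧
    (3 : ℝ) • hexEffect 5 = (2 : ℝ) • hexEffect 0 + (2 : ℝ) • hexEffect 4 - hexEffect 2 := by
  rw [hexEffect_zero, hexEffect_one, hexEffect_two, hexEffect_three, hexEffect_four, hexEffect_five]
  refine ⟨?_, ?_, ?_⟩ <;> ext i <;> fin_cases i <;> simp <;> ring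

theorem pureState_mem_stateSpace {k : ℕ} (h1 : 1 ≤ k) (h6 : k ≤ 6) :
    pureState 6 k ∈ stateSpace 6 :=
  subset_convexHull ℝ _ ⟨k, h1, h6, rfl⟩

/-- Every unnormalized effect is a nonnegative combination of the extreme ones. -/
theorem exists_nonneg_combination {e : Fin 3 → ℝ} (he : e ∈ effectCone 6) :
    ∃ c : Fin 6 → ℝ, (∀ i, 0 ≤ c i) ∧ e = ∑ i : Fin 6, c i • hexEffect i := by
  obtain ⟨p, q, s, hpqs⟩ : ∃ p q s : ℝ, e = p • hexEffect 0 + q • hexEffect 2 + s • hexEffect 4 :=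
    ⟨_, _, _, eq_sum_hexEffect e⟩
  have key : ∀ k : ℕ, 1 ≤ k → k ≤ 6 → ∀ a b c : Fin 6, (-k : ℤ) % 6 = a → (2 - k : ℤ) % 6 = b →
      (4 - k : ℤ) % 6 = c → 0 ≤ p * vertexTable a + q * vertexTable b + s * vertexTable c := by
    intro k h1 h6 a b c ha hb hc
    have := he _ (pureState_mem_stateSpace h1 h6)
    simp only [hpqs, add_dotProduct, smul_dotProduct, smul_eq_mul] at this
    rwa [hexEffect_dotProduct_pureState, hexEffect_dotProduct_pureState 2,
      hexEffect_dotProduct_pureState 4, hexEffect_emod_six (0 - k), hexEffect_emod_six (2 - k),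
      hexEffect_emod_six (4 - k), zero_sub, ha, hb, hc, hexEffect_fin_dotProduct,
      hexEffect_fin_dotProduct, hexEffect_fin_dotProduct] at this
  have k1 := key 1 (by norm_num) (by norm_num) 5 1 3 (by decide) (by decide) (by decide)
  have k2 := key 2 (by norm_num) (by norm_num) 4 0 2 (by decide) (by decide) (by decide)
  have k3 := key 3 (by norm_num) (by norm_num) 3 5 1 (by decide) (by decide) (by decide)
  have k4 := key 4 (by norm_num) (by norm_num) 2 4 0 (by decide) (by decide) (by decide)
  have k5 := key 5 (by norm_num) (by norm_num) 1 3 5 (by decide) (by decide) (by decide)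
  have k6 := key 6 (by norm_num) (by norm_num) 0 2 4 (by decide) (by decide) (by decide)
  simp [vertexTable] at k1 k2 k3 k4 k5 k6
  obtain ⟨h1, h3, h5⟩ := three_smul_hexEffect
  have nn : ∀ c : Fin 6 → ℝ, 0 ≤ c 0 → 0 ≤ c 1 → 0 ≤ c 2 → 0 ≤ c 3 → 0 ≤ c 4 → 0 ≤ c 5 →
      ∀ i, 0 ≤ c i := by
    intro c _ _ _ _ _ _ i; fin_cases i <;> assumption
  -- A negative coefficient is removed by `three_smul_hexEffect`. For `p < 0`, substituting `e₀ = 2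
  -- e₂ + 2 e₄ - 3 e₃` leaves the coefficients `-3 p`, `q + 2 p` and `s + 2 p`; the last two are
  -- values of the effect at vertices. The other two cases are rotations of this one.
  rcases lt_or_ge p 0 with hp | hp
  · refine ⟨![0, 0, q + 2 * p, -3 * p, s + 2 * p, 0], nn _ ?_ ?_ ?_ ?_ ?_ ?_, ?_⟩
    any_goals simp <;> linarith
    rw [hpqs]; simp [Fin.sum_univ_six]
    linear_combination (norm := module) p • h3
  rcases lt_or_ge q 0 with hq | hq
  · refine ⟨![p + 2 * q, 0, 0, 0, s + 2 * q, -3 * q], nn _ ?_ ?_ ?_ ?_ ?_ ?_, ?_⟩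
    any_goals simp <;> linarith
    rw [hpqs]; simp [Fin.sum_univ_six]
    linear_combination (norm := module) q • h5
  rcases lt_or_ge s 0 with hs | hs
  · refine ⟨![p + 2 * s, -3 * s, q + 2 * s, 0, 0, 0], nn _ ?_ ?_ ?_ ?_ ?_ ?_, ?_⟩
    any_goals simp <;> linarith
    rw [hpqs]; simp [Fin.sum_univ_six]
    linear_combination (norm := module) s • h1
  · refine ⟨![p, 0, q, 0, s, 0], nn _ ?_ ?_ ?_ ?_ ?_ ?_, ?_⟩
    any_goals simp <;> linarith
    rw [hpqs]; simp [Fin.sum_univ_six]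

/-! ### The table of values of a bipartite state on the extreme effects -/

/-- The value of the product of the extreme effects with indices `i` and `j`. -/
noncomputable def hexValue (Φ : Matrix (Fin 3) (Fin 3) ℝ) (i j : ℤ) : ℝ :=
  prodEffect (hexEffect i) (hexEffect j) Φ

theorem prodEffect_add_left (e e' f : Fin 3 → ℝ) (Φ : Matrix (Fin 3) (Fin 3) ℝ) :
    prodEffect (e + e') f Φ = prodEffect e f Φ + prodEffect e' f Φ := add_dotProduct ..

theorem prodEffect_smul_left (c : ℝ) (e f : Fin 3 → ℝ) (Φ : Matrix (Fin 3) (Fin 3) ℝ) :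
    prodEffect (c • e) f Φ = c * prodEffect e f Φ := smul_dotProduct ..

theorem prodEffect_add_right (e f f' : Fin 3 → ℝ) (Φ : Matrix (Fin 3) (Fin 3) ℝ) :
    prodEffect e (f + f') Φ = prodEffect e f Φ + prodEffect e f' Φ := by
  simp [prodEffect, mulVec_add]

theorem prodEffect_smul_right (c : ℝ) (e f : Fin 3 → ℝ) (Φ : Matrix (Fin 3) (Fin 3) ℝ) :
    prodEffect e (c • f) Φ = c * prodEffect e f Φ := by
  simp [prodEffect, mulVec_smul]

theorem prodEffect_sum_left {ι : Type*} (s : Finset ι) (e : ι → Fin 3 → ℝ) (f : Fin 3 → ℝ)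
    (Φ : Matrix (Fin 3) (Fin 3) ℝ) :
    prodEffect (∑ i ∈ s, e i) f Φ = ∑ i ∈ s, prodEffect (e i) f Φ := sum_dotProduct ..

theorem prodEffect_sum_right {ι : Type*} (s : Finset ι) (e : Fin 3 → ℝ) (f : ι → Fin 3 → ℝ)
    (Φ : Matrix (Fin 3) (Fin 3) ℝ) :
    prodEffect e (∑ i ∈ s, f i) Φ = ∑ i ∈ s, prodEffect e (f i) Φ := by
  simp only [prodEffect, mulVec_sum, dotProduct_sum]

/-- `hexValue` as a linear functional of the matrix. -/
noncomputable def hexValueₗ (i j : ℤ) : Matrix (Fin 3) (Fin 3) ℝ →ₗ[ℝ] ℝ where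
  toFun Φ := hexValue Φ i j
  map_add' Φ Ψ := by simp [hexValue, prodEffect, add_mulVec]
  map_smul' c Φ := by simp [hexValue, prodEffect, smul_mulVec]

@[simp] theorem hexValueₗ_apply (i j : ℤ) (Φ : Matrix (Fin 3) (Fin 3) ℝ) :
    hexValueₗ i j Φ = hexValue Φ i j := rfl

theorem hexValue_emod (Φ : Matrix (Fin 3) (Fin 3) ℝ) (i j : ℤ) :
    hexValue Φ i j = hexValue Φ (i % 6) (j % 6) := by
  rw [hexValue, hexEffect_emod_six i, hexEffect_emod_six j]; rfl

theorem hexValue_smul (c : ℝ) (Φ : Matrix (Fin 3) (Fin 3) ℝ) (i j : ℤ) :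
    hexValue (c • Φ) i j = c * hexValue Φ i j := (hexValueₗ i j).map_smul c Φ

theorem prodEffect_unitEffect (Φ : Matrix (Fin 3) (Fin 3) ℝ) :
    prodEffect unitEffect unitEffect Φ = Φ 2 2 := by
  simp [prodEffect, unitEffect, dotProduct, mulVec, Fin.sum_univ_three]

/-- Halves of extreme effects are effects, which gives one direction. For the other, any two effects
are expanded in extreme ones with nonnegative coefficients, and the value is bilinear. -/
theorem mem_maxTensor_iff {Φ : Matrix (Fin 3) (Fin 3) ℝ} :
    Φ ∈ maxTensor 6 ↔ (∀ i j, 0 ≤ hexValue Φ i j) ∧ Φ 2 2 = 1 := by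
  rw [← prodEffect_unitEffect Φ]
  refine and_congr_left fun _ => ⟨fun h i j => ?_, fun h e he f hf => ?_⟩
  · have := h _ (half_hexEffect_mem_effectSpace i) _ (half_hexEffect_mem_effectSpace j)
    rw [prodEffect_smul_left, prodEffect_smul_right] at this
    rw [hexValue]; linarith
  · obtain ⟨c, hc, rfl⟩ := exists_nonneg_combination (e := e) fun ω hω => (he ω hω).1
    obtain ⟨d, hd, rfl⟩ := exists_nonneg_combination (e := f) fun ω hω => (hf ω hω).1
    simp only [prodEffect_sum_left, prodEffect_sum_right, prodEffect_smul_left,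
      prodEffect_smul_right]
    exact Finset.sum_nonneg fun j _ => mul_nonneg (hd j) <| Finset.sum_nonneg fun i _ =>
      mul_nonneg (hc i) (h _ _)

/-- A matrix is determined by nine values, through the dual basis. -/
theorem prodEffect_eq_sum (e f : Fin 3 → ℝ) (Φ : Matrix (Fin 3) (Fin 3) ℝ) :
    prodEffect e f Φ = ∑ a : Fin 3, ∑ b : Fin 3,
      (e ⬝ᵥ dualState a) * (f ⬝ᵥ dualState b) * hexValue Φ (2 * a) (2 * b) := by
  conv_lhs => rw [eq_sum_hexEffect e, eq_sum_hexEffect f]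
  simp only [prodEffect_add_left, prodEffect_add_right, prodEffect_smul_left,
    prodEffect_smul_right, Fin.sum_univ_three, hexValue]
  simp
  ring

theorem ext_hexValue {Φ Ψ : Matrix (Fin 3) (Fin 3) ℝ}
    (h : ∀ a b : Fin 3, hexValue Φ (2 * a) (2 * b) = hexValue Ψ (2 * a) (2 * b)) : Φ = Ψ := by
  have key : ∀ e f, prodEffect e f Φ = prodEffect e f Ψ := by
    intro e f; rw [prodEffect_eq_sum, prodEffect_eq_sum]; simp only [h]
  ext i j
  simpa [prodEffect] using key (Pi.single i 1) (Pi.single j 1)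

/-- The unit effect is one third of the sum of the three basis effects. This converts the
normalization of a state into a condition on its nine coordinates and is the source of the factor 9
below. -/
theorem apply_two_two_eq_sum (Φ : Matrix (Fin 3) (Fin 3) ℝ) :
    9 * Φ 2 2 = ∑ a : Fin 3, ∑ b : Fin 3, hexValue Φ (2 * a) (2 * b) := by
  have : ∀ a, unitEffect ⬝ᵥ dualState a = 1 / 3 := by
    intro a; fin_cases a <;> simp [unitEffect, dualState, dotProduct, Fin.sum_univ_three]
  rw [← prodEffect_unitEffect Φ, prodEffect_eq_sum]
  simp only [this, ← Finset.mul_sum]; ring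

/-- Extreme points of the maximal tensor product are determined by their zeros. -/
theorem mem_extremePoints_maxTensor_iff {Φ : Matrix (Fin 3) (Fin 3) ℝ} :
    Φ ∈ (maxTensor 6).extremePoints ℝ ↔ Φ ∈ maxTensor 6 ∧
      ∀ D, (∀ i j, hexValue Φ i j = 0 → hexValue D i j = 0) → ∃ c : ℝ, D = c • Φ := by
  constructor
  · intro h
    refine ⟨h.1, fun D hD => ⟨D 2 2, ?_⟩⟩
    have hΦ := mem_maxTensor_iff.1 h.1
    -- The correction makes the perturbation parallel to the hyperplane of normalized matrices.
    set D' := D - D 2 2 • Φ with hD'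
    have hz : ∀ i j, hexValue Φ i j = 0 → hexValue D' i j = 0 := fun i j hij => by
      have : hexValue D' i j = hexValue D i j - D 2 2 * hexValue Φ i j := by
        simp only [← hexValueₗ_apply, hD', map_sub, map_smul, smul_eq_mul]
      rw [this, hij, hD i j hij]; simp
    have h22 : D' 2 2 = 0 := by simp [hD', hΦ.2]
    -- Only finitely many values matter: those that are zero stay zero, and the positive ones
    -- survive a small perturbation in either direction. Then `Φ` is the midpoint of two states, so
    -- the perturbation is zero.
    obtain ⟨ε, hε, hε0⟩ : ∃ ε : ℝ, (∀ p : Fin 6 × Fin 6, 0 ≤ hexValue Φ p.1 p.2 + ε * hexValue D' p.1 p.2 ∧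
        0 ≤ hexValue Φ p.1 p.2 - ε * hexValue D' p.1 p.2) ∧ 0 < ε := by
      have : ∀ᶠ ε in nhdsWithin (0 : ℝ) (Set.Ioi 0), ∀ p : Fin 6 × Fin 6,
          0 ≤ hexValue Φ p.1 p.2 + ε * hexValue D' p.1 p.2 ∧
          0 ≤ hexValue Φ p.1 p.2 - ε * hexValue D' p.1 p.2 := by
        refine Filter.eventually_all.2 fun p => ?_
        rcases (hΦ.1 p.1 p.2).eq_or_lt with h0 | h0
        · filter_upwards with ε
          rw [hz _ _ h0.symm, ← h0]; simp
        · refine Filter.Eventually.filter_mono nhdsWithin_le_nhds ?_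
          have c1 : Continuous fun ε : ℝ => hexValue Φ p.1 p.2 + ε * hexValue D' p.1 p.2 := by
            fun_prop
          have c2 : Continuous fun ε : ℝ => hexValue Φ p.1 p.2 - ε * hexValue D' p.1 p.2 := by
            fun_prop
          filter_upwards [(c1.tendsto 0).eventually_const_lt (u := 0) (by simpa using h0),
            (c2.tendsto 0).eventually_const_lt (u := 0) (by simpa using h0)] with ε h1 h2
          exact ⟨h1.le, h2.le⟩
      exact (this.and self_mem_nhdsWithin).exists
    have hval : ∀ s : ℝ, (∀ p : Fin 6 × Fin 6, 0 ≤ hexValue Φ p.1 p.2 + s * hexValue D' p.1 p.2) →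
        Φ + s • D' ∈ maxTensor 6 := by
      intro s hs
      refine mem_maxTensor_iff.2 ⟨fun i j => ?_, by simp [h22, hΦ.2]⟩
      have e : hexValue (Φ + s • D') i j = hexValue Φ i j + s * hexValue D' i j := by
        simp only [← hexValueₗ_apply, map_add, map_smul, smul_eq_mul]
      obtain ⟨a, ha⟩ := exists_fin_hexEffect i
      obtain ⟨b, hb⟩ := exists_fin_hexEffect j
      rw [e]
      have := hs (a, b)
      simp only [hexValue] at this ⊢
      rwa [ha, hb]
    have h1 := hval ε fun p => (hε p).1
    have h2 := hval (-ε) fun p => by have := (hε p).2; rwa [neg_mul, ← sub_eq_add_neg]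
    have := h.2 h1 h2 ⟨1 / 2, 1 / 2, by norm_num, by norm_num, by norm_num, by module⟩
    have hD0 : D' = 0 := by
      have : ε • D' = 0 := by simpa using this
      exact (smul_eq_zero.1 this).resolve_left hε0.ne'
    exact sub_eq_zero.1 (hD' ▸ hD0)
  · rintro ⟨hΦ, h⟩
    refine ⟨hΦ, fun y hy z hz => ?_⟩
    rintro ⟨a, b, ha, hb, hab, rfl⟩
    have hy' := mem_maxTensor_iff.1 hy
    have hz' := mem_maxTensor_iff.1 hz
    have hw := mem_maxTensor_iff.1 hΦ
    -- If a positive combination of nonnegative numbers is zero, each of them is. So `y` vanishes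
    -- wherever `Φ` does and is a multiple of it; normalization makes the factor 1.
    obtain ⟨c, hc⟩ := h y fun i j hij => by
      have e : hexValue (a • y + b • z) i j = a * hexValue y i j + b * hexValue z i j := by
        simp only [← hexValueₗ_apply, map_add, map_smul, smul_eq_mul]
      rw [e] at hij
      have h1 := mul_nonneg ha.le (hy'.1 i j)
      have h2 := mul_nonneg hb.le (hz'.1 i j)
      have : a * hexValue y i j = 0 := by linarith
      exact (mul_eq_zero.1 this).resolve_left ha.ne'
    have hc1 : c = 1 := by
      have := congrFun (congrFun hc 2) 2
      rw [Matrix.smul_apply, hw.2, hy'.2] at this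
      simpa using this.symm
    rw [hc1, one_smul] at hc
    exact hc

/-! ### The action of the symmetries -/

theorem prodEffect_localAction (e f : Fin 3 → ℝ) (S T Φ : Matrix (Fin 3) (Fin 3) ℝ) :
    prodEffect e f (localAction S T Φ) = prodEffect (Sᵀ *ᵥ e) (Tᵀ *ᵥ f) Φ := by
  simp only [prodEffect, localAction, ← mulVec_mulVec, Matrix.mulVec_transpose S,
    ← Matrix.dotProduct_mulVec]

/-- The symmetries of the index set of the extreme effects. -/
def dihedralIndex (s : Bool) (k i : ℤ) : ℤ := if s then i + k else k - i

/-- The effect of index `i` points at angle `π i / 3 + π / 2`, so the reflection in the first axis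
acts on indices by `i ↦ 3 - i`. This explains the shift by 3 for reflections; the sign `-k` for
rotations comes from the transpose. -/
theorem planarIsometry_transpose_mulVec (s : Bool) (k i : ℤ) :
    (planarIsometry (Real.pi * (if s then -k else k + 3 : ℤ) / 3) (if s then 1 else -1))ᵀ *ᵥ
      hexEffect i = hexEffect (dihedralIndex s k i) := by
  cases s
  · have e : Real.pi * (k - i : ℤ) / 3 = Real.pi * (k + 3 : ℤ) / 3 - Real.pi * i / 3 - Real.pi := by
      push_cast; ring
    simp only [dihedralIndex, hexEffect, Bool.false_eq_true, if_false, e,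
      Real.sin_sub_pi (_ - _), Real.cos_sub_pi (_ - _), Real.sin_sub, Real.cos_sub]
    ext a; fin_cases a <;>
      simp [planarIsometry, mulVec, dotProduct, Fin.sum_univ_three] <;> ring
  · have e : Real.pi * (i + k : ℤ) / 3 = Real.pi * i / 3 - Real.pi * (-k : ℤ) / 3 := by
      push_cast; ring
    simp only [dihedralIndex, hexEffect, if_true, e, Real.sin_sub, Real.cos_sub]
    ext a; fin_cases a <;>
      simp [planarIsometry, mulVec, dotProduct, Fin.sum_univ_three] <;> ring

theorem exists_dihedralIndex {S : Matrix (Fin 3) (Fin 3) ℝ} (hS : S ∈ reversibleTransformations 6) :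
    ∃ s k, ∀ i, Sᵀ *ᵥ hexEffect i = hexEffect (dihedralIndex s k i) := by
  obtain ⟨m, s, rfl | rfl, rfl⟩ := mem_reversibleTransformations_iff.1 hS
  · exact ⟨true, -m, fun i => by simpa using planarIsometry_transpose_mulVec true (-m) i⟩
  · exact ⟨false, m - 3, fun i => by simpa using planarIsometry_transpose_mulVec false (m - 3) i⟩

theorem exists_reversible_of_dihedralIndex (s : Bool) (k : ℤ) :
    ∃ S ∈ reversibleTransformations 6, ∀ i, Sᵀ *ᵥ hexEffect i = hexEffect (dihedralIndex s k i) :=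
  ⟨_, mem_reversibleTransformations_iff.2 ⟨_, _, by cases s <;> simp, rfl⟩,
    planarIsometry_transpose_mulVec s k⟩

theorem exists_hexValue_localAction {S T : Matrix (Fin 3) (Fin 3) ℝ}
    (hS : S ∈ reversibleTransformations 6) (hT : T ∈ reversibleTransformations 6) :
    ∃ s k t l, ∀ Φ i j, hexValue (localAction S T Φ) i j =
      hexValue Φ (dihedralIndex s k i) (dihedralIndex t l j) := by
  obtain ⟨s, k, h⟩ := exists_dihedralIndex hS
  obtain ⟨t, l, h'⟩ := exists_dihedralIndex hT
  exact ⟨s, k, t, l, fun Φ i j => by rw [hexValue, prodEffect_localAction, h, h']; rfl⟩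

theorem exists_localAction_of_dihedralIndex (s : Bool) (k : ℤ) (t : Bool) (l : ℤ) :
    ∃ S ∈ reversibleTransformations 6, ∃ T ∈ reversibleTransformations 6,
      ∀ Φ i j, hexValue (localAction S T Φ) i j =
        hexValue Φ (dihedralIndex s k i) (dihedralIndex t l j) := by
  obtain ⟨S, hS, h⟩ := exists_reversible_of_dihedralIndex s k
  obtain ⟨T, hT, h'⟩ := exists_reversible_of_dihedralIndex t l
  exact ⟨S, hS, T, hT, fun Φ i j => by rw [hexValue, prodEffect_localAction, h, h']; rfl⟩

theorem localAction_apply_two_two {S T : Matrix (Fin 3) (Fin 3) ℝ}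
    (hS : S ∈ reversibleTransformations 6) (hT : T ∈ reversibleTransformations 6)
    (Φ : Matrix (Fin 3) (Fin 3) ℝ) : localAction S T Φ 2 2 = Φ 2 2 := by
  obtain ⟨m, s, -, rfl⟩ := mem_reversibleTransformations_iff.1 hS
  obtain ⟨l, t, -, rfl⟩ := mem_reversibleTransformations_iff.1 hT
  simp [localAction, planarIsometry, Matrix.mul_apply, Fin.sum_univ_three, vecMul, dotProduct]

theorem mem_maxTensor_of_locallyEquivalent {Φ Ψ : Matrix (Fin 3) (Fin 3) ℝ}
    (h : LocallyEquivalent 6 Φ Ψ) (hΦ : Φ ∈ maxTensor 6) : Ψ ∈ maxTensor 6 := by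
  obtain ⟨S, hS, T, hT, rfl⟩ := h
  obtain ⟨s, k, t, l, hv⟩ := exists_hexValue_localAction hS hT
  rw [mem_maxTensor_iff] at hΦ ⊢
  exact ⟨fun i j => by rw [hv]; exact hΦ.1 _ _, by rw [localAction_apply_two_two hS hT, hΦ.2]⟩

/-- The criterion by zeros is invariant: a matrix that vanishes with the image is pulled back by the
inverse symmetry, compared with `Φ`, and pushed forward again. -/
theorem mem_extremePoints_of_locallyEquivalent {Φ Ψ : Matrix (Fin 3) (Fin 3) ℝ}
    (h : LocallyEquivalent 6 Φ Ψ) (hΦ : Φ ∈ (maxTensor 6).extremePoints ℝ) :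
    Ψ ∈ (maxTensor 6).extremePoints ℝ := by
  have hΨ := mem_maxTensor_of_locallyEquivalent h hΦ.1
  obtain ⟨S, hS, T, hT, rfl⟩ := h
  obtain ⟨S', hS', h1, h1'⟩ := exists_inv_mem_reversibleTransformations hS
  obtain ⟨T', hT', h2, h2'⟩ := exists_inv_mem_reversibleTransformations hT
  obtain ⟨s, k, t, l, hv⟩ := exists_hexValue_localAction hS' hT'
  have hinv : localAction S' T' (localAction S T Φ) = Φ := by
    rw [localAction_localAction, h1, h2, localAction_one]
  refine mem_extremePoints_maxTensor_iff.2 ⟨hΨ, fun D hD => ?_⟩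
  obtain ⟨c, hc⟩ := (mem_extremePoints_maxTensor_iff.1 hΦ).2 (localAction S' T' D) fun i j hij => by
    rw [hv]
    apply hD
    rw [← hv, hinv, hij]
  refine ⟨c, ?_⟩
  rw [← localAction_smul, ← hc, localAction_localAction, h1', h2', localAction_one]

/-! ### Product states -/

theorem vecMulVec_mem_maxTensor {a b : Fin 3 → ℝ} (ha : a ∈ stateSpace 6) (hb : b ∈ stateSpace 6) :
    vecMulVec a b ∈ maxTensor 6 := by
  have h2 : ∀ ω ∈ stateSpace 6, unitEffect ⬝ᵥ ω = 1 := by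
    intro ω hω
    have hconv : Convex ℝ {ω : Fin 3 → ℝ | unitEffect ⬝ᵥ ω ∈ ({1} : Set ℝ)} :=
      (convex_singleton (1 : ℝ)).is_linear_preimage
        ⟨fun x y => dotProduct_add _ x y, fun c x => dotProduct_smul c _ x⟩
    have h : ω ∈ {ω : Fin 3 → ℝ | unitEffect ⬝ᵥ ω ∈ ({1} : Set ℝ)} := by
      refine convexHull_min ?_ hconv hω
      rintro _ ⟨k, -, -, rfl⟩
      simp [unitEffect, pureState, dotProduct, Fin.sum_univ_three]
    exact h
  have hp : ∀ e f : Fin 3 → ℝ, prodEffect e f (vecMulVec a b) = (e ⬝ᵥ a) * (f ⬝ᵥ b) := by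
    intro e f
    simp only [prodEffect, dotProduct, mulVec, vecMulVec_apply, Fin.sum_univ_three]; ring
  refine ⟨fun e he f hf => ?_, ?_⟩
  · rw [hp]; exact mul_nonneg (he a ha).1 (hf b hb).1
  · rw [hp, h2 a ha, h2 b hb, one_mul]

/-- The minimal tensor product lies inside the maximal one, so an extreme point of the larger set
that lies in the smaller is extreme there too, and extreme points of a convex hull belong to the
generating set. -/
theorem exists_vecMulVec_of_mem_minTensor {Φ : Matrix (Fin 3) (Fin 3) ℝ}
    (h : Φ ∈ (maxTensor 6).extremePoints ℝ) (hmin : Φ ∈ minTensor 6) :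
    ∃ a ∈ stateSpace 6, ∃ b ∈ stateSpace 6, Φ = vecMulVec a b := by
  have hsub : {Φ | ∃ a ∈ stateSpace 6, ∃ b ∈ stateSpace 6, Φ = vecMulVec a b} ⊆ maxTensor 6 := by
    rintro _ ⟨a, ha, b, hb, rfl⟩; exact vecMulVec_mem_maxTensor ha hb
  have hconv : Convex ℝ (maxTensor 6) := by
    intro x hx y hy a b ha hb hab
    rw [mem_maxTensor_iff] at *
    refine ⟨fun i j => ?_, by simp [hx.2, hy.2, hab]⟩
    have e : hexValue (a • x + b • y) i j = a * hexValue x i j + b * hexValue y i j := by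
      simp only [← hexValueₗ_apply, map_add, map_smul, smul_eq_mul]
    rw [e]
    exact add_nonneg (mul_nonneg ha (hx.1 i j)) (mul_nonneg hb (hy.1 i j))
  have := inter_extremePoints_subset_extremePoints_of_subset (convexHull_min hsub hconv) ⟨hmin, h⟩
  have := extremePoints_convexHull_subset this
  exact this

theorem mulVec_mem_stateSpace {S : Matrix (Fin 3) (Fin 3) ℝ} (hS : S ∈ reversibleTransformations 6)
    {ω : Fin 3 → ℝ} (hω : ω ∈ stateSpace 6) : S *ᵥ ω ∈ stateSpace 6 := by
  have hconv : Convex ℝ {ω : Fin 3 → ℝ | S *ᵥ ω ∈ stateSpace 6} :=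
    (convex_convexHull ℝ _).is_linear_preimage
      ⟨fun x y => mulVec_add _ x y, fun c x => mulVec_smul _ c x⟩
  refine convexHull_min ?_ hconv hω
  rintro _ ⟨i, -, -, rfl⟩
  obtain ⟨m, s, hs, rfl⟩ := mem_reversibleTransformations_iff.1 hS
  obtain ⟨n, hn⟩ : ∃ n : ℤ, (n : ℝ) = m + s * i := by
    rcases hs with rfl | rfl
    · exact ⟨m + i, by push_cast; ring⟩
    · exact ⟨m - i, by push_cast; ring⟩
  obtain ⟨k, q, hk, hk', hm⟩ : ∃ k : ℕ, ∃ q : ℤ, 1 ≤ k ∧ k ≤ 6 ∧ n = k + 6 * q :=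
    ⟨((n - 1) % 6 + 1).toNat, (n - 1) / 6, by omega, by omega, by omega⟩
  suffices planarIsometry (Real.pi * m / 3) s *ᵥ pureState 6 i = pureState 6 k by
    rw [Set.mem_ofPred_eq, this]; exact pureState_mem_stateSpace hk hk'
  have e : 2 * Real.pi * k / (6 : ℕ) = Real.pi * m / 3 + s * (2 * Real.pi * i / (6 : ℕ)) -
      q * (2 * Real.pi) := by
    have : (m : ℝ) + s * i = k + 6 * q := by rw [← hn, hm]; push_cast; ring
    push_cast; linear_combination -(Real.pi / 3) * this
  simp only [pureState, e, Real.cos_sub_int_mul_two_pi, Real.sin_sub_int_mul_two_pi]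
  rcases hs with rfl | rfl <;> ext a <;> fin_cases a <;>
    simp [planarIsometry, mulVec, dotProduct, Fin.sum_univ_three, Real.cos_add, Real.sin_add] <;>
    ring

theorem localAction_vecMulVec (S T : Matrix (Fin 3) (Fin 3) ℝ) (a b : Fin 3 → ℝ) :
    localAction S T (vecMulVec a b) = vecMulVec (S *ᵥ a) (T *ᵥ b) := by
  rw [localAction, mul_vecMulVec, vecMulVec_mul, vecMul_transpose]

theorem mem_minTensor_of_locallyEquivalent {Φ Ψ : Matrix (Fin 3) (Fin 3) ℝ}
    (h : LocallyEquivalent 6 Φ Ψ) (hΦ : Φ ∈ minTensor 6) : Ψ ∈ minTensor 6 := by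
  obtain ⟨S, hS, T, hT, rfl⟩ := h
  have hconv : Convex ℝ {Φ : Matrix (Fin 3) (Fin 3) ℝ | localAction S T Φ ∈ minTensor 6} :=
    (convex_convexHull ℝ _).is_linear_preimage
      ⟨fun x y => by simp [localAction, Matrix.mul_add, Matrix.add_mul],
        fun c x => localAction_smul S T x c⟩
  refine convexHull_min ?_ hconv hΦ
  rintro _ ⟨a, ha, b, hb, rfl⟩
  exact subset_convexHull ℝ _ ⟨_, mulVec_mem_stateSpace hS ha, _, mulVec_mem_stateSpace hT hb,
    localAction_vecMulVec ..⟩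

theorem mem_extremeEntangled_of_locallyEquivalent {Φ Ψ : Matrix (Fin 3) (Fin 3) ℝ}
    (h : LocallyEquivalent 6 Φ Ψ) (hΦ : Φ ∈ extremeEntangled 6) : Ψ ∈ extremeEntangled 6 :=
  ⟨mem_extremePoints_of_locallyEquivalent h hΦ.1, fun hm =>
    hΦ.2 (mem_minTensor_of_locallyEquivalent (locallyEquivalent_equivalence.symm h) hm)⟩

/-! ### The double description method, in a form that the kernel can run -/

/-- `forceInt x k = k x`; evaluating it first brings `x` to normal form. -/
def forceInt {β : Type*} (x : ℤ) (k : ℤ → β) : β :=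
  match x with
  | .ofNat n => Nat.rec (motive := fun _ => β) (k (.ofNat 0)) (fun m _ => k (.ofNat m.succ)) n
  | .negSucc n => Nat.rec (motive := fun _ => β) (k (.negSucc 0)) (fun m _ => k (.negSucc m.succ)) n

/-- `forceNat n k = k n`; evaluating it first brings `n` to normal form. -/
def forceNat {β : Type*} (n : ℕ) (k : ℕ → β) : β :=
  Nat.rec (motive := fun _ => β) (k 0) (fun m _ => k m.succ) n

/-- `forceList f l k = k l`; evaluating it first brings `l` to normal form,
the entries by means of `f`. -/
def forceList {α β : Type*} (f : α → (α → β) → β) : List α → (List α → β) → β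
  | [], k => k []
  | a :: l, k => f a fun a' => forceList f l fun l' => k (a' :: l')

/-- `forceSpine l k = k l`; evaluating it first brings the spine of `l` to normal form. -/
def forceSpine {α β : Type*} : List α → (List α → β) → β :=
  forceList fun a k => k a

/-- A ray of a cone, given by a bit mask of constraints that vanish on it and the
list of its values at the constraints still to be imposed. -/
abbrev RayEntry := ℕ × List ℤ

def RayEntry.force {β : Type*} (e : RayEntry) (k : RayEntry → β) : β :=
  forceNat e.1 fun m => forceList forceInt e.2 fun l => k (m, l)

/-- `M` is covered if one of the entries vanishes on all constraints in `M`. -/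
def coveredBy (M : ℕ) (G : List RayEntry) : Bool :=
  List.rec (motive := fun _ => Bool) false
    (fun e _ ih => Bool.rec (motive := fun _ => Bool) ih true (Nat.beq (Nat.land M e.1) M)) G

/-- The combination `c • x + d • y` of two lists of integers. -/
def combineLists (c d : ℕ) : List ℤ → List ℤ → List ℤ
  | [], ys => ys.map fun y => d * y
  | xs, [] => xs.map fun x => c * x
  | x :: xs, y :: ys => (c * x + d * y) :: combineLists c d xs ys

/-- The positive combination of `p` and `n` whose head vanishes. -/
def eliminate (M : ℕ) (p n : RayEntry) : RayEntry :=
  (M, forceNat (p.2.headD 0).natAbs fun s => forceNat (n.2.headD 0).natAbs fun t =>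
    forceNat (t / s.gcd t) fun c => forceNat (s / s.gcd t) fun d =>
      combineLists c d p.2.tail n.2.tail)

/-- Insert the combinations of `p` with the members of `N`, except those that are covered. -/
def insertPairs (bit : ℕ) (p : RayEntry) (N : List RayEntry) : List RayEntry → List RayEntry :=
  List.rec (motive := fun _ => List RayEntry → List RayEntry) (fun acc => acc)
    (fun n _ ih acc => forceNat (Nat.lor (Nat.land p.1 n.1) bit) fun M =>
      Bool.rec (motive := fun _ => List RayEntry)
        ((eliminate M p n).force fun y =>
          forceSpine (acc.filter fun e => !(Nat.beq (Nat.land e.1 M) e.1)) fun acc' => ih (y :: acc'))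
        (ih acc) (coveredBy M acc)) N

/-- Insert the combinations of all members of `P` with all members of `N`. -/
def insertAllPairs (bit : ℕ) (N P : List RayEntry) : List RayEntry → List RayEntry :=
  List.rec (motive := fun _ => List RayEntry → List RayEntry) (fun acc => acc)
    (fun p _ ih acc => ih (insertPairs bit p N acc)) P

def positiveEntries (G : List RayEntry) : List RayEntry :=
  G.filter fun e => decide (0 < e.2.headD 0)

def zeroEntries (G : List RayEntry) : List RayEntry :=
  G.filter fun e => decide (e.2.headD 0 = 0)

def negativeEntries (G : List RayEntry) : List RayEntry :=
  G.filter fun e => decide (e.2.headD 0 < 0)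

/-- Remove the head of the list of values and replace the mask by `m`. -/
def RayEntry.advance {β : Type*} (m : ℕ) (e : RayEntry) (k : RayEntry → β) : β :=
  forceNat m fun m => List.casesOn (motive := fun _ => β) e.2 (k (m, [])) fun _ l => k (m, l)

/-- One step of the double description method: impose the first of the remaining constraints. -/
def ddStep {β : Type*} (b : ℕ) (G : List RayEntry) (k : List RayEntry → β) : β :=
  forceNat (2 ^ b) fun bit =>
    forceSpine (positiveEntries G) fun P => forceSpine (negativeEntries G) fun N =>
      forceList (fun e => e.advance (Nat.lor e.1 bit)) (zeroEntries G) fun Z =>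
        forceSpine (insertAllPairs bit N P Z) fun A =>
          forceList (fun e => e.advance e.1) P fun P' => forceSpine (A ++ P') k

/-- The continuation style, together with the forcing functions, makes the kernel normalize each
intermediate list once instead of carrying unevaluated terms along. -/
def ddRun {β : Type*} : ℕ → ℕ → List RayEntry → (List RayEntry → β) → β
  | 0, _, G, k => k G
  | n + 1, b, G, k => ddStep b G fun G' => ddRun n (b + 1) G' k

/-! ### Correctness of the double description method -/

@[simp] theorem forceNat_eq {β : Type*} (n : ℕ) (k : ℕ → β) : forceNat n k = k n := by
  cases n <;> rfl

@[simp] theorem forceInt_eq {β : Type*} (x : ℤ) (k : ℤ → β) : forceInt x k = k x := by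
  rcases x with (_ | _) | (_ | _) <;> rfl

theorem forceList_eq {α β : Type*} {f : α → (α → β) → β} {g : α → α} (hf : ∀ a k, f a k = k (g a))
    (l : List α) (k : List α → β) : forceList f l k = k (l.map g) := by
  induction l generalizing k with
  | nil => rfl
  | cons a l ih => rw [forceList, hf, ih]; rfl

@[simp] theorem forceSpine_eq {α β : Type*} (l : List α) (k : List α → β) :
    forceSpine l k = k l :=
  (forceList_eq (g := id) (fun _ _ => rfl) l k).trans (by rw [List.map_id])

@[simp] theorem RayEntry.force_eq {β : Type*} (e : RayEntry) (k : RayEntry → β) :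
    e.force k = k e := by
  rw [RayEntry.force, forceNat_eq]
  exact (forceList_eq (g := id) (fun _ _ => forceInt_eq _ _) e.2 _).trans (by rw [List.map_id])

@[simp] theorem RayEntry.advance_eq {β : Type*} (m : ℕ) (e : RayEntry) (k : RayEntry → β) :
    e.advance m k = k (m, e.2.tail) := by
  rw [RayEntry.advance, forceNat_eq]; rcases e with ⟨m', _ | _⟩ <;> rfl

theorem combineLists_getD (c d : ℕ) (xs ys : List ℤ) (i : ℕ) :
    (combineLists c d xs ys).getD i 0 = c * xs.getD i 0 + d * ys.getD i 0 := by
  induction xs generalizing ys i with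
  | nil =>
    simp only [combineLists, List.getD_eq_getElem?_getD, List.getElem?_map]
    cases ys[i]? <;> simp
  | cons x xs ih =>
    cases ys with
    | nil =>
      simp only [combineLists, List.getD_eq_getElem?_getD, List.getElem?_map]
      cases (x :: xs)[i]? <;> simp
    | cons y ys => cases i with
      | zero => simp [combineLists]
      | succ i => simpa [combineLists] using ih ys i

/-- The bits of `M` are among those of `m`. -/
def MaskLE (M m : ℕ) : Prop := ∀ j, M.testBit j = true → m.testBit j = true

theorem maskLE_of_beq {M m : ℕ} (h : Nat.beq (Nat.land M m) M = true) : MaskLE M m := by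
  intro j hj
  have h' : M &&& m = M := Nat.eq_of_beq_eq_true h
  rw [← h', Nat.testBit_and, Bool.and_eq_true] at hj
  exact hj.2

theorem coveredBy_cons (M : ℕ) (a : RayEntry) (G : List RayEntry) : coveredBy M (a :: G) =
    Bool.rec (motive := fun _ => Bool) (coveredBy M G) true (Nat.beq (Nat.land M a.1) M) := rfl

theorem exists_of_coveredBy {M : ℕ} {G : List RayEntry} (h : coveredBy M G = true) :
    ∃ e ∈ G, MaskLE M e.1 := by
  induction G with
  | nil => exact absurd h (by simp [coveredBy])
  | cons a G ih =>
    by_cases ha : Nat.beq (Nat.land M a.1) M = true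
    · exact ⟨a, by simp, maskLE_of_beq ha⟩
    · have h' : coveredBy M (a :: G) = coveredBy M G := by
        rw [Bool.not_eq_true] at ha
        rw [coveredBy_cons, ha]
      obtain ⟨e, he, hM⟩ := ih (h' ▸ h)
      exact ⟨e, by simp [he], hM⟩

/-- The mask of the combination of two entries. -/
def pairMask (bit : ℕ) (p n : RayEntry) : ℕ := Nat.lor (Nat.land p.1 n.1) bit

theorem insertPairs_cons (bit : ℕ) (p n : RayEntry) (N acc : List RayEntry) :
    insertPairs bit p (n :: N) acc =
      if coveredBy (pairMask bit p n) acc = true then insertPairs bit p N acc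
      else insertPairs bit p N (eliminate (pairMask bit p n) p n ::
        acc.filter fun e => !(Nat.beq (Nat.land e.1 (pairMask bit p n)) e.1)) := by
  have h : insertPairs bit p (n :: N) acc = forceNat (pairMask bit p n) fun M =>
      Bool.rec (motive := fun _ => List RayEntry)
        ((eliminate M p n).force fun y =>
          forceSpine (acc.filter fun e => !(Nat.beq (Nat.land e.1 M) e.1)) fun acc' =>
            insertPairs bit p N (y :: acc'))
        (insertPairs bit p N acc) (coveredBy M acc) := rfl
  rw [h, forceNat_eq]
  cases coveredBy (pairMask bit p n) acc
  · rw [RayEntry.force_eq, forceSpine_eq, if_neg (by decide)]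
  · rfl

/-- The three parts are provenance, preservation of coverage, and coverage of every new pair. They
justify both prunings: a skipped combination has its mask contained in that of a present entry, and
a deleted entry has its mask contained in that of the entry just inserted. -/
theorem insertPairs_spec (bit : ℕ) (p : RayEntry) (N acc : List RayEntry) :
    (∀ e ∈ insertPairs bit p N acc, e ∈ acc ∨ ∃ n ∈ N, e = eliminate (pairMask bit p n) p n) ∧
    (∀ M, (∃ e ∈ acc, MaskLE M e.1) → ∃ e ∈ insertPairs bit p N acc, MaskLE M e.1) ∧
    (∀ n ∈ N, ∃ e ∈ insertPairs bit p N acc, MaskLE (pairMask bit p n) e.1) := by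
  induction N generalizing acc with
  | nil => exact ⟨fun e he => Or.inl he, fun M h => h, by simp⟩
  | cons n N ih =>
    rw [insertPairs_cons]
    split_ifs with hc
    · obtain ⟨h1, h2, h3⟩ := ih acc
      refine ⟨fun e he => ?_, h2, ?_⟩
      · rcases h1 e he with h | ⟨m, hm, h⟩
        · exact Or.inl h
        · exact Or.inr ⟨m, by simp [hm], h⟩
      · intro m hm
        rcases List.mem_cons.1 hm with rfl | hm
        · exact h2 _ (exists_of_coveredBy hc)
        · exact h3 m hm
    · set M := pairMask bit p n
      set acc' := eliminate M p n :: acc.filter fun e => !(Nat.beq (Nat.land e.1 M) e.1) with hacc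
      obtain ⟨h1, h2, h3⟩ := ih acc'
      have hM : ∃ e ∈ acc', MaskLE M e.1 := ⟨_, List.mem_cons_self, fun j hj => hj⟩
      refine ⟨fun e he => ?_, fun M' ⟨e, he, hM'⟩ => ?_, fun m hm => ?_⟩
      · rcases h1 e he with h | ⟨m, hm, h⟩
        · rcases List.mem_cons.1 h with h | h
          · exact Or.inr ⟨n, by simp, h⟩
          · exact Or.inl (List.mem_filter.1 h).1
        · exact Or.inr ⟨m, by simp [hm], h⟩
      · apply h2
        by_cases hb : Nat.beq (Nat.land e.1 M) e.1 = true
        · exact ⟨_, List.mem_cons_self, fun j hj => maskLE_of_beq hb j (hM' j hj)⟩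
        · exact ⟨e, List.mem_cons_of_mem _ (List.mem_filter.2 ⟨he, by rw [Bool.not_eq_true] at hb; rw [hb]; rfl⟩), hM'⟩
      · rcases List.mem_cons.1 hm with rfl | hm
        · exact h2 _ hM
        · exact h3 m hm

theorem insertAllPairs_spec (bit : ℕ) (N P acc : List RayEntry) :
    (∀ e ∈ insertAllPairs bit N P acc,
      e ∈ acc ∨ ∃ p ∈ P, ∃ n ∈ N, e = eliminate (pairMask bit p n) p n) ∧
    (∀ M, (∃ e ∈ acc, MaskLE M e.1) → ∃ e ∈ insertAllPairs bit N P acc, MaskLE M e.1) ∧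
    (∀ p ∈ P, ∀ n ∈ N, ∃ e ∈ insertAllPairs bit N P acc, MaskLE (pairMask bit p n) e.1) := by
  induction P generalizing acc with
  | nil => exact ⟨fun e he => Or.inl he, fun M h => h, by simp⟩
  | cons p P ih =>
    obtain ⟨i1, i2, i3⟩ := insertPairs_spec bit p N acc
    obtain ⟨h1, h2, h3⟩ := ih (insertPairs bit p N acc)
    refine ⟨fun e he => ?_, fun M h => h2 M (i2 M h), fun q hq n hn => ?_⟩
    · rcases h1 e he with h | ⟨q, hq, n, hn, h⟩
      · rcases i1 e h with h | ⟨n, hn, h⟩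
        · exact Or.inl h
        · exact Or.inr ⟨p, by simp, n, hn, h⟩
      · exact Or.inr ⟨q, by simp [hq], n, hn, h⟩
    · rcases List.mem_cons.1 hq with rfl | hq
      · exact h2 _ (i3 n hn)
      · exact h3 q hq n hn

/-- The result of `ddStep`, without the forced evaluation. -/
def ddNext (b : ℕ) (G : List RayEntry) : List RayEntry :=
  insertAllPairs (2 ^ b) (negativeEntries G) (positiveEntries G)
      ((zeroEntries G).map fun e => (Nat.lor e.1 (2 ^ b), e.2.tail)) ++
    (positiveEntries G).map fun e => (e.1, e.2.tail)

theorem ddStep_eq {β : Type*} (b : ℕ) (G : List RayEntry) (k : List RayEntry → β) :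
    ddStep b G k = k (ddNext b G) := by
  rw [ddStep, forceNat_eq, forceSpine_eq, forceSpine_eq]
  rw [forceList_eq (g := fun e => (Nat.lor e.1 (2 ^ b), e.2.tail)) fun _ _ => RayEntry.advance_eq ..]
  rw [forceSpine_eq]
  rw [forceList_eq (g := fun e => (e.1, e.2.tail)) fun _ _ => RayEntry.advance_eq ..]
  rw [forceSpine_eq]; rfl

section Cone

variable {E : Type*} [AddCommGroup E] [Module ℝ E] (φ : ℕ → E →ₗ[ℝ] ℝ) (V : Submodule ℝ E)

/-- The vector `g` belongs to the cone cut out by the first `b` constraints, and `e` records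
constraints that vanish on it and its values at the other ones. -/
structure Represents (b : ℕ) (e : RayEntry) (g : E) : Prop where
  mem : g ∈ V
  nonneg : ∀ j < b, 0 ≤ φ j g
  pos : ∃ j < b, 0 < φ j g
  zero : ∀ j, e.1.testBit j = true → j < b ∧ φ j g = 0
  val : ∀ i, φ (b + i) g = (e.2.getD i 0 : ℤ)

/-- Every entry of `G` represents a vector of the cone cut out by the first `b` constraints,
and every face of that cone contains one of these vectors. -/
structure HitsAllFaces (b : ℕ) (G : List RayEntry) : Prop where
  represents : ∀ e ∈ G, ∃ g, Represents φ V b e g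
  cover : ∀ x ∈ V, x ≠ 0 → (∀ j < b, 0 ≤ φ j x) →
    ∃ e ∈ G, ∀ j < b, φ j x = 0 → e.1.testBit j = true

variable {φ V}

/-- A nonzero vector of the cone is a positive combination of represented vectors in its face. -/
theorem HitsAllFaces.mem_of_forall {b : ℕ} {G : List RayEntry} (h : HitsAllFaces φ V b G) (Q : Set E)
    (hadd : ∀ y ∈ Q, ∀ z ∈ Q, y + z ∈ Q) (hsmul : ∀ c : ℝ, 0 < c → ∀ y ∈ Q, c • y ∈ Q)
    {x : E} (hV : x ∈ V) (hx0 : x ≠ 0) (hx : ∀ j < b, 0 ≤ φ j x)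
    (hQ : ∀ e ∈ G, (∀ j < b, φ j x = 0 → e.1.testBit j = true) →
      ∀ g, Represents φ V b e g → g ∈ Q) : x ∈ Q := by
  classical
  induction hn : ((Finset.range b).filter fun j => φ j x ≠ 0).card using Nat.strong_induction_on
    generalizing x with
  | _ n ih =>
    obtain ⟨e, he, hcov⟩ := h.cover x hV hx0 hx
    obtain ⟨g, hg⟩ := h.represents e he
    have hgQ := hQ e he hcov g hg
    have hz : ∀ j < b, φ j x = 0 → φ j g = 0 := fun j hj hxj => (hg.zero j (hcov j hj hxj)).2
    obtain ⟨j₀, hj₀, hgj₀⟩ := hg.pos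
    -- The minimal ratio gives the largest multiple of `g` that can be subtracted from `x` inside
    -- the cone. The constraint `m` becomes zero and no zero is lost, so the number of nonzero
    -- constraints drops.
    obtain ⟨m, hm, hmin⟩ := ((Finset.range b).filter fun j => 0 < φ j g).exists_min_image
      (fun j => φ j x / φ j g) ⟨j₀, by simp [hj₀, hgj₀]⟩
    rw [Finset.mem_filter, Finset.mem_range] at hm
    have hxm : 0 < φ m x := (hx m hm.1).lt_of_ne fun h0 => hm.2.ne' (hz m hm.1 h0.symm)
    set ε := φ m x / φ m g with hε
    have hε0 : 0 < ε := div_pos hxm hm.2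
    have hφ : ∀ j, φ j (x - ε • g) = φ j x - ε * φ j g := fun j => by simp
    have hnn : ∀ j < b, 0 ≤ φ j (x - ε • g) := by
      intro j hj
      rw [hφ]
      rcases (hg.nonneg j hj).eq_or_lt with h0 | h0
      · rw [← h0]; simpa using hx j hj
      · have := hmin j (by simp [hj, h0])
        rw [le_div_iff₀ h0] at this
        linarith
    have hz' : ∀ j < b, φ j x = 0 → φ j (x - ε • g) = 0 := fun j hj hxj => by
      rw [hφ, hxj, hz j hj hxj]; simp
    have hmz : φ m (x - ε • g) = 0 := by
      rw [hφ, hε, div_mul_cancel₀ _ hm.2.ne', sub_self]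
    have hdec : x = (x - ε • g) + ε • g := by abel
    by_cases hx' : x - ε • g = 0
    · rw [hdec, hx', zero_add]; exact hsmul ε hε0 g hgQ
    · rw [hdec]
      refine hadd _ ?_ _ (hsmul ε hε0 g hgQ)
      refine ih _ ?_ (V.sub_mem hV (V.smul_mem _ hg.mem)) hx' hnn (fun e' he' hcov' => ?_) rfl
      · rw [← hn]
        refine Finset.card_lt_card ⟨fun j hj => ?_, fun hsub => ?_⟩
        · rw [Finset.mem_filter, Finset.mem_range] at hj ⊢
          exact ⟨hj.1, fun h0 => hj.2 (hz' j hj.1 h0)⟩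
        · have := hsub (by simp [hm.1, hxm.ne'] : m ∈ (Finset.range b).filter fun j => φ j x ≠ 0)
          rw [Finset.mem_filter] at this
          exact this.2 hmz
      · exact hQ e' he' fun j hj hxj => hcov' j hj (hz' j hj hxj)

theorem of_testBit_pairMask {b : ℕ} {p n : RayEntry} {j : ℕ}
    (h : (pairMask (2 ^ b) p n).testBit j = true) :
    (p.1.testBit j = true ∧ n.1.testBit j = true) ∨ j = b := by
  change ((p.1 &&& n.1) ||| 2 ^ b).testBit j = true at h
  rw [Nat.testBit_or, Nat.testBit_and, Nat.testBit_two_pow, Bool.or_eq_true, Bool.and_eq_true] at h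
  rcases h with h | h
  · exact Or.inl h
  · exact Or.inr (of_decide_eq_true h).symm

theorem testBit_pairMask {b : ℕ} {p n : RayEntry} {j : ℕ}
    (h : (p.1.testBit j = true ∧ n.1.testBit j = true) ∨ j = b) :
    (pairMask (2 ^ b) p n).testBit j = true := by
  change ((p.1 &&& n.1) ||| 2 ^ b).testBit j = true
  rw [Nat.testBit_or, Nat.testBit_and, Nat.testBit_two_pow, Bool.or_eq_true, Bool.and_eq_true]
  exact h.imp id fun h => decide_eq_true h.symm

theorem Represents.head {b : ℕ} {e : RayEntry} {g : E} (h : Represents φ V b e g) :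
    φ b g = (e.2.headD 0 : ℤ) := by
  have := h.val 0
  rw [add_zero] at this
  rw [this]; rcases e with ⟨m, _ | _⟩ <;> rfl

theorem Represents.tail {b : ℕ} {e : RayEntry} {g : E} (h : Represents φ V b e g) (i : ℕ) :
    φ (b + 1 + i) g = (e.2.tail.getD i 0 : ℤ) := by
  have := h.val (i + 1)
  rw [show b + 1 + i = b + (i + 1) by omega, this]
  rcases e with ⟨m, _ | _⟩ <;> rfl

/-- The coefficients satisfy `c * s = d * t`, where `s` and `-t` are the values of the two vectors
at the new constraint, so the combination vanishes there. It is nonzero because `x` is positive at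
an earlier constraint and `y` is nonnegative at it. -/
theorem Represents.eliminate {b : ℕ} {p n : RayEntry} {x y : E} (hp : Represents φ V b p x)
    (hn : Represents φ V b n y) (hp0 : 0 < p.2.headD 0) (hn0 : n.2.headD 0 < 0) :
    ∃ g, Represents φ V (b + 1) (eliminate (pairMask (2 ^ b) p n) p n) g := by
  set s := (p.2.headD 0).natAbs with hs
  set t := (n.2.headD 0).natAbs with ht
  set c := t / s.gcd t
  set d := s / s.gcd t
  have hspos : 0 < s := by omega
  have htpos : 0 < t := by omega
  have hc : 0 < c := Nat.div_pos (Nat.le_of_dvd htpos (Nat.gcd_dvd_right s t))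
    (Nat.gcd_pos_of_pos_left _ hspos)
  have hb : φ b ((c : ℝ) • x + (d : ℝ) • y) = 0 := by
    rw [map_add, map_smul, map_smul, hp.head, hn.head,
      show p.2.headD 0 = s by omega, show n.2.headD 0 = -t by omega]
    have : c * s = d * t := by
      rw [mul_comm c s, ← Nat.mul_div_assoc _ (Nat.gcd_dvd_right s t), Nat.div_mul_right_comm
        (Nat.gcd_dvd_left s t)]
    have : (c : ℝ) * s = d * t := by exact_mod_cast this
    simp only [smul_eq_mul]; push_cast; linarith
  have hφ : ∀ j, φ j ((c : ℝ) • x + (d : ℝ) • y) = c * φ j x + d * φ j y := fun j => by simp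
  refine ⟨(c : ℝ) • x + (d : ℝ) • y, V.add_mem (V.smul_mem _ hp.mem) (V.smul_mem _ hn.mem),
    fun j hj => ?_, ?_, fun j hj => ?_, fun i => ?_⟩
  · rcases Nat.lt_succ_iff_lt_or_eq.1 hj with hj | rfl
    · rw [hφ]
      exact add_nonneg (mul_nonneg c.cast_nonneg (hp.nonneg j hj))
        (mul_nonneg d.cast_nonneg (hn.nonneg j hj))
    · exact hb.ge
  · obtain ⟨j, hj, hj'⟩ := hp.pos
    refine ⟨j, by omega, ?_⟩
    rw [hφ]
    exact add_pos_of_pos_of_nonneg (mul_pos (by exact_mod_cast hc) hj')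
        (mul_nonneg d.cast_nonneg (hn.nonneg j hj))
  · rcases of_testBit_pairMask hj with ⟨h1, h2⟩ | rfl
    · have h1 := hp.zero j h1
      have h2 := hn.zero j h2
      exact ⟨by omega, by rw [hφ, h1.2, h2.2]; simp⟩
    · exact ⟨by omega, hb⟩
  · rw [hφ, hp.tail, hn.tail]
    rw [_root_.eliminate]
    simp only [forceNat_eq, ← hs, ← ht]
    rw [combineLists_getD]; push_cast; rfl

/-- The invariant needs no adjacency test and no minimality of the list. A face of the new cone on
the hyperplane of the new constraint contains either an old entry on that hyperplane or a
combination of a positive and a negative old entry of the same old face; any other face contains a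
positive old entry. -/
theorem HitsAllFaces.ddNext {b : ℕ} {G : List RayEntry} (h : HitsAllFaces φ V b G) :
    HitsAllFaces φ V (b + 1) (ddNext b G) := by
  obtain ⟨h1, h2, h3⟩ := insertAllPairs_spec (2 ^ b) (negativeEntries G) (positiveEntries G)
    ((zeroEntries G).map fun e => (Nat.lor e.1 (2 ^ b), e.2.tail))
  have hpos : ∀ e, e ∈ positiveEntries G ↔ e ∈ G ∧ 0 < e.2.headD 0 := by simp [positiveEntries]
  have hneg : ∀ e, e ∈ negativeEntries G ↔ e ∈ G ∧ e.2.headD 0 < 0 := by simp [negativeEntries]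
  have hzero : ∀ e, e ∈ zeroEntries G ↔ e ∈ G ∧ e.2.headD 0 = 0 := by simp [zeroEntries]
  have htb : ∀ (m j : ℕ), (Nat.lor m (2 ^ b)).testBit j = true ↔ m.testBit j = true ∨ b = j := by
    intro m j
    change (m ||| 2 ^ b).testBit j = true ↔ _
    rw [Nat.testBit_or, Nat.testBit_two_pow, Bool.or_eq_true, decide_eq_true_iff]
  constructor
  · intro e he
    rcases List.mem_append.1 he with he | he
    · rcases h1 e he with he | ⟨p, hp, n, hn, rfl⟩
      · obtain ⟨f, hf, rfl⟩ := List.mem_map.1 he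
        rw [hzero] at hf
        obtain ⟨g, hg⟩ := h.represents f hf.1
        have hb : φ b g = 0 := by rw [hg.head, hf.2]; simp
        refine ⟨g, hg.mem, fun j hj => ?_, ?_, fun j hj => ?_, hg.tail⟩
        · rcases Nat.lt_succ_iff_lt_or_eq.1 hj with hj | rfl
          · exact hg.nonneg j hj
          · exact hb.ge
        · obtain ⟨j, hj, hj'⟩ := hg.pos
          exact ⟨j, by omega, hj'⟩
        · rcases (htb _ _).1 hj with hj | rfl
          · have := hg.zero j hj
            exact ⟨by omega, this.2⟩
          · exact ⟨by omega, hb⟩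
      · rw [hpos] at hp
        rw [hneg] at hn
        obtain ⟨x, hx⟩ := h.represents p hp.1
        obtain ⟨y, hy⟩ := h.represents n hn.1
        exact hx.eliminate hy hp.2 hn.2
    · obtain ⟨f, hf, rfl⟩ := List.mem_map.1 he
      rw [hpos] at hf
      obtain ⟨g, hg⟩ := h.represents f hf.1
      have hb : 0 < φ b g := by rw [hg.head]; exact_mod_cast hf.2
      refine ⟨g, hg.mem, fun j hj => ?_, ⟨b, by omega, hb⟩, fun j hj => ?_, hg.tail⟩
      · rcases Nat.lt_succ_iff_lt_or_eq.1 hj with hj | rfl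
        · exact hg.nonneg j hj
        · exact hb.le
      · have := hg.zero j hj
        exact ⟨by omega, this.2⟩
  · intro x hV hx0 hx
    have hx' : ∀ j < b, 0 ≤ φ j x := fun j hj => hx j (by omega)
    have hmem := fun Q hadd hsmul => h.mem_of_forall Q hadd hsmul hV hx0 hx'
    rcases (hx b (by omega)).eq_or_lt with hb | hb
    · have lift : ∀ M, (∀ j < b, φ j x = 0 → M.testBit j = true) → M.testBit b = true →
          (∃ e ∈ insertAllPairs (2 ^ b) (negativeEntries G) (positiveEntries G)
            ((zeroEntries G).map fun e => (Nat.lor e.1 (2 ^ b), e.2.tail)), MaskLE M e.1) →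
          ∃ e ∈ _root_.ddNext b G, ∀ j < b + 1, φ j x = 0 → e.1.testBit j = true := by
        rintro M hM hMb ⟨e, he, hle⟩
        refine ⟨e, List.mem_append_left _ he, fun j hj hxj => hle j ?_⟩
        rcases Nat.lt_succ_iff_lt_or_eq.1 hj with hj | rfl
        · exact hM j hj hxj
        · exact hMb
      by_cases hz : ∃ e ∈ G, (∀ j < b, φ j x = 0 → e.1.testBit j = true) ∧ e.2.headD 0 = 0
      · obtain ⟨e, he, hcov, h0⟩ := hz
        refine lift (Nat.lor e.1 (2 ^ b)) (fun j hj hxj => (htb _ _).2 (Or.inl (hcov j hj hxj)))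
          ((htb _ _).2 (Or.inr rfl)) (h2 _ ⟨_, List.mem_map.2 ⟨e, (hzero e).2 ⟨he, h0⟩, rfl⟩,
            fun j hj => hj⟩)
      -- Entries of the face with value zero are excluded by `hz`. Without a positive one all would
      -- be negative, and then so would `x`, being a positive combination of vectors represented by
      -- them.
      have hp : ∃ p ∈ G, (∀ j < b, φ j x = 0 → p.1.testBit j = true) ∧ 0 < p.2.headD 0 := by
        by_contra! hcon
        have := hmem {y | φ b y < 0} (fun y hy z hz => by
            simp only [Set.mem_ofPred_eq, map_add] at hy hz ⊢; linarith)
          (fun c hc y hy => by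
            simp only [Set.mem_ofPred_eq, map_smul, smul_eq_mul] at hy ⊢
            exact mul_neg_of_pos_of_neg hc hy)
          (fun e he hcov g hg => by
            rw [Set.mem_ofPred_eq, hg.head]
            exact_mod_cast lt_of_le_of_ne (hcon e he hcov) fun h0 => hz ⟨e, he, hcov, h0⟩)
        rw [Set.mem_ofPred_eq, ← hb] at this
        exact lt_irrefl _ this
      have hn : ∃ n ∈ G, (∀ j < b, φ j x = 0 → n.1.testBit j = true) ∧ n.2.headD 0 < 0 := by
        by_contra! hcon
        have := hmem {y | 0 < φ b y} (fun y hy z hz => by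
            simp only [Set.mem_ofPred_eq, map_add] at hy hz ⊢; linarith)
          (fun c hc y hy => by
            simp only [Set.mem_ofPred_eq, map_smul, smul_eq_mul] at hy ⊢
            exact mul_pos hc hy)
          (fun e he hcov g hg => by
            rw [Set.mem_ofPred_eq, hg.head]
            exact_mod_cast lt_of_le_of_ne (hcon e he hcov) fun h0 => hz ⟨e, he, hcov, h0.symm⟩)
        rw [Set.mem_ofPred_eq, ← hb] at this
        exact lt_irrefl _ this
      obtain ⟨p, hp, hpc, hp0⟩ := hp
      obtain ⟨n, hn, hnc, hn0⟩ := hn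
      exact lift (pairMask (2 ^ b) p n)
        (fun j hj hxj => testBit_pairMask (Or.inl ⟨hpc j hj hxj, hnc j hj hxj⟩))
        (testBit_pairMask (Or.inr rfl)) (h3 p ((hpos p).2 ⟨hp, hp0⟩) n ((hneg n).2 ⟨hn, hn0⟩))
    · have hp : ∃ p ∈ G, (∀ j < b, φ j x = 0 → p.1.testBit j = true) ∧ 0 < p.2.headD 0 := by
        by_contra! hcon
        have := hmem {y | φ b y ≤ 0} (fun y hy z hz => by
            simp only [Set.mem_ofPred_eq, map_add] at hy hz ⊢; linarith)
          (fun c hc y hy => by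
            simp only [Set.mem_ofPred_eq, map_smul, smul_eq_mul] at hy ⊢
            exact mul_nonpos_of_nonneg_of_nonpos hc.le hy)
          (fun e he hcov g hg => by
            rw [Set.mem_ofPred_eq, hg.head]
            exact_mod_cast hcon e he hcov)
        rw [Set.mem_ofPred_eq] at this
        linarith
      obtain ⟨p, hp, hpc, hp0⟩ := hp
      refine ⟨_, List.mem_append_right _ (List.mem_map.2 ⟨p, (hpos p).2 ⟨hp, hp0⟩, rfl⟩),
        fun j hj hxj => ?_⟩
      rcases Nat.lt_succ_iff_lt_or_eq.1 hj with hj | rfl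
      · exact hpc j hj hxj
      · exact absurd hxj hb.ne'

/-- The final list is described only through the Boolean tests applied to it, so one evaluation of
one test suffices and the list never has to be written out. -/
theorem HitsAllFaces.ddRun {b : ℕ} {G : List RayEntry} (h : HitsAllFaces φ V b G) (n : ℕ) :
    ∃ G', HitsAllFaces φ V (b + n) G' ∧ ∀ k : List RayEntry → Bool, ddRun n b G k = k G' := by
  induction n generalizing b G with
  | zero => exact ⟨G, h, fun _ => rfl⟩
  | succ n ih =>
    obtain ⟨G', hG', hk⟩ := ih h.ddNext
    refine ⟨G', by rwa [show b + (n + 1) = b + 1 + n by omega], fun k => ?_⟩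
    rw [_root_.ddRun, ddStep_eq, hk]

end Cone

/-! ### The integer data of the hexagon -/

/-- Coefficients of the extreme effects, multiplied by `effectWeight`, in the basis that
consists of the effects with indices `0`, `2`, `4`. -/
def effectCoeffs : List (List ℤ) :=
  [[1, 0, 0], [2, 2, -1], [0, 1, 0], [-1, 2, 2], [0, 0, 1], [2, -1, 2]]

def effectCoeff (i a : ℕ) : ℤ := (effectCoeffs.getD i []).getD a 0

def effectWeight (i : ℕ) : ℤ := if i % 2 = 0 then 1 else 3

/-- The values of the six entangled classes and of the product states, multiplied by
`classDenominator`, on the extreme effects. -/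
def classTables : List (List (List ℤ)) :=
  [[[2, 2, 1, 0, 0, 1], [1, 2, 2, 1, 0, 0], [0, 1, 2, 2, 1, 0],
    [0, 0, 1, 2, 2, 1], [1, 0, 0, 1, 2, 2], [2, 1, 0, 0, 1, 2]],
   [[12, 4, 0, 4, 12, 16], [4, 0, 0, 4, 8, 8], [0, 0, 1, 2, 2, 1],
    [4, 4, 2, 0, 0, 2], [12, 8, 2, 0, 4, 10], [16, 8, 1, 2, 10, 17]],
   [[8, 2, 0, 4, 10, 12], [2, 0, 1, 4, 6, 5], [0, 1, 2, 2, 1, 0],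
    [4, 4, 2, 0, 0, 2], [10, 6, 1, 0, 4, 9], [12, 5, 0, 2, 9, 14]],
   [[16, 4, 0, 8, 20, 24], [6, 0, 1, 8, 14, 13], [0, 0, 2, 4, 4, 2],
    [4, 4, 2, 0, 0, 2], [14, 8, 1, 0, 6, 13], [20, 8, 0, 4, 16, 24]],
   [[16, 6, 0, 4, 14, 20], [4, 0, 0, 4, 8, 8], [0, 1, 2, 2, 1, 0],
    [8, 8, 4, 0, 0, 4], [20, 14, 4, 0, 6, 16], [24, 13, 2, 2, 13, 24]],
   [[1, 2, 2, 1, 0, 0], [2, 1, 0, 0, 1, 2], [2, 0, 0, 2, 4, 4],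
    [1, 0, 2, 5, 6, 4], [0, 1, 4, 6, 5, 2], [0, 2, 4, 4, 2, 0]],
   [[1, 0, 0, 1, 2, 2], [0, 0, 0, 0, 0, 0], [0, 0, 0, 0, 0, 0],
    [1, 0, 0, 1, 2, 2], [2, 0, 0, 2, 4, 4], [2, 0, 0, 2, 4, 4]]]

def classValue (k i j : ℕ) : ℤ := ((classTables.getD k []).getD i []).getD j 0

def classDenominator (k : ℕ) : ℤ := [1, 5, 4, 7, 7, 2, 1].getD k 1

theorem classDenominator_pos (k : ℕ) : 0 < classDenominator k := by
  rcases lt_or_ge k 7 with h | h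
  · interval_cases k <;> decide
  · rw [classDenominator, List.getD_eq_default _ _ (by simpa using h)]; decide

/-- Representatives of the six entangled classes and of the class of the product states. -/
noncomputable def classRep : Fin 7 → Matrix (Fin 3) (Fin 3) ℝ :=
  ![hexPhiI, hexPhiII, hexPhiIII, hexPhiIV, hexPhiV, hexPhiVI,
    vecMulVec (pureState 6 6) (pureState 6 6)]

theorem classRep_castSucc (k : Fin 6) : classRep k.castSucc = hexPhi k := by
  fin_cases k <;> rfl

/-- The matrices of bipartite states in units in which their values are rational. -/
noncomputable def scaledMatrix (a b c d e f g h : ℝ) : Matrix (Fin 3) (Fin 3) ℝ :=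
  let q := (polygonRadius 6)⁻¹
  !![a * q ^ 2, b, c * q ^ 3; d, e * q ^ 2, f * q; g * q ^ 3, h * q, 1]

/-- With `q` the inverse radius, the relations `r * q = 1` and `q ^ 4 = 3 / 4` cancel every
irrational factor, since the powers of `q` in the matrix match the coordinates of the effects. -/
theorem hexValue_scaledMatrix (a b c d e f g h : ℝ) :
    (Matrix.of fun x y : Fin 3 => hexValue (scaledMatrix a b c d e f g h) (2 * x) (2 * y)) =
    !![e + f + h + 1, -d - e / 2 + f - 3 / 4 * g - h / 2 + 1, d - e / 2 + f + 3 / 4 * g - h / 2 + 1;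
       -b - e / 2 - 3 / 4 * c - f / 2 + h + 1,
       3 / 4 * a + b / 2 - 3 / 4 * c + d / 2 + e / 4 - f / 2 - 3 / 4 * g - h / 2 + 1,
       -(3 / 4 * a) + b / 2 - 3 / 4 * c - d / 2 + e / 4 - f / 2 + 3 / 4 * g - h / 2 + 1;
       b - e / 2 + 3 / 4 * c - f / 2 + h + 1,
       -(3 / 4 * a) - b / 2 + 3 / 4 * c + d / 2 + e / 4 - f / 2 - 3 / 4 * g - h / 2 + 1,
       3 / 4 * a - b / 2 + 3 / 4 * c - d / 2 + e / 4 - f / 2 + 3 / 4 * g - h / 2 + 1] := by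
  have hr := polygonRadius_six_pos.ne'
  have h4 := polygonRadius_six_pow_four
  set r := polygonRadius 6
  obtain ⟨q, hq⟩ : ∃ q, q = r⁻¹ := ⟨_, rfl⟩
  have hrq : r * q = 1 := by rw [hq]; exact mul_inv_cancel₀ hr
  have hq4 : q ^ 4 = 3 / 4 := by rw [hq, inv_pow, h4]; norm_num
  have e0 : hexEffect 0 = ![0, r, 1] := hexEffect_zero
  have e2 : hexEffect 2 = ![-q, -(r / 2), 1] := by rw [hexEffect_two, hq, one_div]
  have e4 : hexEffect 4 = ![q, -(r / 2), 1] := by rw [hexEffect_four, hq, one_div]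
  have hm : scaledMatrix a b c d e f g h =
      !![a * q ^ 2, b, c * q ^ 3; d, e * q ^ 2, f * q; g * q ^ 3, h * q, 1] := by rw [hq]; rfl
  rw [hm]
  ext x y
  fin_cases x <;> fin_cases y <;>
    simp [hexValue, prodEffect, e0, e2, e4, mulVec, dotProduct, Fin.sum_univ_three] <;> grind

theorem classDenominator_mul_hexValue_even (k : Fin 7) (a b : Fin 3) :
    classDenominator k * hexValue (classRep k) (2 * a) (2 * b) = classValue k (2 * a) (2 * b) := by
  have hr := polygonRadius_six_pos.ne'
  have h4 := polygonRadius_six_pow_four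
  have hc : Real.cos (Real.pi / 6) = 1 / polygonRadius 6 ^ 2 := by
    rw [Real.cos_pi_div_six]
    have := polygonRadius_six_sq_mul
    field_simp; linarith
  have hr2 : polygonRadius 6 ^ 2 = 4 / 3 * (polygonRadius 6)⁻¹ ^ 2 := by
    field_simp; linarith
  have hr1 : polygonRadius 6 = 4 / 3 * (polygonRadius 6)⁻¹ ^ 3 := by
    field_simp; linarith
  -- The eight rational parameters are read off each representative after `cos (π / 6) = q ^ 2`, `r
  -- ^ 2 = 4 / 3 * q ^ 2` and `r = 4 / 3 * q ^ 3`.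
  obtain ⟨a', b', c, d, e, f, g, h, hk, hz⟩ : ∃ a' b' c d e f g h : ℝ,
      classRep k = scaledMatrix a' b' c d e f g h ∧ ∀ z, Matrix.of (fun x y : Fin 3 =>
        hexValue (scaledMatrix a' b' c d e f g h) (2 * x) (2 * y)) a b = z →
        classDenominator k * z = classValue k (2 * a) (2 * b) := by
    fin_cases k
    · refine ⟨1, 1 / 2, 0, -1 / 2, 1, 0, 0, 0, ?_, ?_⟩
      · simp [classRep, hexPhiI, scaledMatrix, hc, Real.sin_pi_div_six, neg_div]
      · rw [hexValue_scaledMatrix]; rintro _ rfl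
        fin_cases a <;> fin_cases b <;> norm_num [classDenominator, classValue, classTables]
    · refine ⟨1 / 15, 7 / 10, 2 / 3, 7 / 10, 1 / 5, 3 / 5, 2 / 3, 3 / 5, ?_, ?_⟩
      · simp [classRep, hexPhiII, scaledMatrix, div_eq_mul_inv]; ring_nf; simp
      · rw [hexValue_scaledMatrix]; rintro _ rfl
        fin_cases a <;> fin_cases b <;> norm_num [classDenominator, classValue, classTables]
    · refine ⟨1 / 3, 3 / 4, 2 / 3, 3 / 4, 0, 1 / 2, 2 / 3, 1 / 2, ?_, ?_⟩
      · simp [classRep, hexPhiIII, scaledMatrix, h4, div_eq_mul_inv]; ring_nf; simp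
      · rw [hexValue_scaledMatrix]; rintro _ rfl
        fin_cases a <;> fin_cases b <;> norm_num [classDenominator, classValue, classTables]
    · refine ⟨1 / 7, 9 / 14, 10 / 21, 11 / 14, 1 / 7, 5 / 7, 6 / 7, 3 / 7, ?_, ?_⟩
      · simp [classRep, hexPhiIV, scaledMatrix, div_eq_mul_inv]; ring_nf; simp
      · rw [hexValue_scaledMatrix]; rintro _ rfl
        fin_cases a <;> fin_cases b <;> norm_num [classDenominator, classValue, classTables]
    · refine ⟨1 / 7, 11 / 14, 6 / 7, 9 / 14, 1 / 7, 3 / 7, 10 / 21, 5 / 7, ?_, ?_⟩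
      · simp [classRep, hexPhiV, scaledMatrix, div_eq_mul_inv]; ring_nf; simp
      · rw [hexValue_scaledMatrix]; rintro _ rfl
        fin_cases a <;> fin_cases b <;> norm_num [classDenominator, classValue, classTables]
    · refine ⟨-1 / 2, -3 / 4, 1 / 3, -3 / 4, 1 / 2, -1 / 2, 1 / 3, -1 / 2, ?_, ?_⟩
      · simp [classRep, hexPhiVI, scaledMatrix, h4, div_eq_mul_inv]; ring_nf; simp
      · rw [hexValue_scaledMatrix]; rintro _ rfl
        fin_cases a <;> fin_cases b <;> norm_num [classDenominator, classValue, classTables]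
    · refine ⟨4 / 3, 0, 4 / 3, 0, 0, 0, 4 / 3, 0, ?_, ?_⟩
      · have e : classRep 6 = !![polygonRadius 6 ^ 2, 0, polygonRadius 6; 0, 0, 0;
            polygonRadius 6, 0, 1] := by
          simp only [classRep, pureState_six_six]
          ext x y; fin_cases x <;> fin_cases y <;> simp [sq]
        refine e.trans ?_
        rw [hr2]
        ext x y; fin_cases x <;> fin_cases y <;> simp [scaledMatrix] <;> simpa using hr1
      · rw [hexValue_scaledMatrix]; rintro _ rfl
        fin_cases a <;> fin_cases b <;> norm_num [classDenominator, classValue, classTables]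
  rw [hk]
  exact hz _ rfl

theorem effectWeight_pos (i : ℕ) : 0 < effectWeight i := by
  rw [effectWeight]; split_ifs <;> decide

theorem effectWeight_mul_dotProduct (i : Fin 6) (a : Fin 3) :
    effectWeight i * (hexEffect i ⬝ᵥ dualState a) = effectCoeff i a := by
  have h := polygonRadius_six_pos.ne'
  fin_cases i <;> fin_cases a <;>
    simp [effectWeight, effectCoeff, effectCoeffs, dualState, hexEffect_zero, hexEffect_one,
      hexEffect_two, hexEffect_three, hexEffect_four, hexEffect_five, dotProduct,
      Fin.sum_univ_three] <;> field_simp <;> norm_num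

theorem effectWeight_mul_hexValue (Φ : Matrix (Fin 3) (Fin 3) ℝ) (i j : Fin 6) :
    (effectWeight i * effectWeight j : ℤ) * hexValue Φ i j = ∑ a : Fin 3, ∑ b : Fin 3,
      (effectCoeff i a * effectCoeff j b : ℤ) * hexValue Φ (2 * a) (2 * b) := by
  rw [hexValue, prodEffect_eq_sum, Finset.mul_sum]
  refine Finset.sum_congr rfl fun a _ => ?_
  rw [Finset.mul_sum]
  refine Finset.sum_congr rfl fun b _ => ?_
  push_cast
  rw [← effectWeight_mul_dotProduct, ← effectWeight_mul_dotProduct]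
  ring

/-- Consistency of the integer tables: the even rows and columns determine the rest, so checking
nine values per class against the matrices is enough. -/
theorem classValue_eq_sum : ∀ (k : Fin 7) (i j : Fin 6),
    effectWeight i * effectWeight j * classValue k i j = ∑ a : Fin 3, ∑ b : Fin 3,
      effectCoeff i a * effectCoeff j b * classValue k (2 * a) (2 * b) := by
  decide +kernel

theorem classDenominator_mul_hexValue_fin (k : Fin 7) (i j : Fin 6) :
    classDenominator k * hexValue (classRep k) i j = classValue k i j := by
  have hw : ((effectWeight i * effectWeight j : ℤ) : ℝ) ≠ 0 := by
    exact_mod_cast (mul_pos (effectWeight_pos i) (effectWeight_pos j)).ne'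
  refine mul_left_cancel₀ hw ?_
  rw [mul_left_comm, effectWeight_mul_hexValue, Finset.mul_sum]
  have := congrArg (Int.cast : ℤ → ℝ) (classValue_eq_sum k i j)
  rw [Int.cast_mul] at this
  rw [this, Int.cast_sum]
  refine Finset.sum_congr rfl fun a _ => ?_
  rw [Finset.mul_sum, Int.cast_sum]
  refine Finset.sum_congr rfl fun b _ => ?_
  rw [mul_left_comm, classDenominator_mul_hexValue_even, ← Int.cast_mul]

/-- Reduction of the index of an extreme effect. -/
def foldIndex (i : ℤ) : ℕ := (i % 6).toNat

theorem classDenominator_mul_hexValue (k : Fin 7) (i j : ℤ) :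
    classDenominator k * hexValue (classRep k) i j = classValue k (foldIndex i) (foldIndex j) := by
  have h := classDenominator_mul_hexValue_fin k ⟨foldIndex i, by unfold foldIndex; omega⟩
    ⟨foldIndex j, by unfold foldIndex; omega⟩
  have hf : ∀ i : ℤ, (foldIndex i : ℤ) = i % 6 := fun i => by unfold foldIndex; omega
  simp only [hf] at h
  rwa [← hexValue_emod] at h

/-! ### The double description of the states that vanish on the effect pair `(0, 0)` -/

/-- Indices in the basis of effects of the coordinates other than the first. -/
def coordPairs : List (ℕ × ℕ) :=
  [(0, 1), (0, 2), (1, 0), (1, 1), (1, 2), (2, 0), (2, 1), (2, 2)]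

/-- The pairs of effects whose nonnegativity is imposed one by one, in an order that keeps
the number of rays small. -/
def cutPairs : List (ℕ × ℕ) :=
  [(2, 1), (4, 5), (5, 0), (3, 0), (1, 5), (5, 1), (5, 5), (0, 5), (2, 3), (1, 1), (4, 3), (0, 1),
    (1, 0), (0, 3), (5, 3), (3, 2), (3, 3), (3, 1), (2, 5), (3, 4), (4, 1), (1, 4), (1, 3), (1, 2),
    (5, 4), (3, 5), (5, 2)]

def evenPairs : List (ℕ × ℕ) := coordPairs.map fun c => (2 * c.1, 2 * c.2)

/-- Positions 0 to 7 bound the initial simplicial cone and 8 to 34 are the cuts. The coordinates are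
repeated at 35 to 42 and never imposed there: the value lists carry them through the run, so they
are exactly what is left at the end. -/
def constraintPairs : List (ℕ × ℕ) := evenPairs ++ (cutPairs ++ evenPairs)

/-- The default matters: beyond the list the functional is the value on (0, 0), which vanishes on
`zeroFace`, in agreement with the default 0 of the value lists. -/
def constraintPair (j : ℕ) : ℕ × ℕ := constraintPairs.getD j (0, 0)

def coordPair (k : ℕ) : ℕ × ℕ := coordPairs.getD k (0, 0)

/-- The value on the pair `c` of effects of the `k`-th coordinate matrix. -/
def pairCoeff (k : ℕ) (c : ℕ × ℕ) : ℤ :=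
  effectCoeff c.1 (coordPair k).1 * effectCoeff c.2 (coordPair k).2

/-- The rays of the simplicial cone of eight nonnegative coordinates. The mask `255 - 2 ^ k` has all
bits below 8 except `k`. -/
def initialEntries : List RayEntry :=
  (List.range 8).map fun k => (255 - 2 ^ k, (cutPairs ++ evenPairs).map (pairCoeff k))

/-- The values on the coordinate pairs of the `k`-th class, after two symmetries. -/
def orbitRow (k : ℕ) (s : Bool) (p : ℕ) (t : Bool) (q : ℕ) : List ℤ :=
  evenPairs.map fun c =>
    classValue k (foldIndex (dihedralIndex s p c.1)) (foldIndex (dihedralIndex t q c.2))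

/-- The elements of the orbits of the class representatives that vanish on the pair `(0, 0)`. -/
def orbitRows : List (ℤ × List ℤ) :=
  (List.range 7).flatMap fun k => [true, false].flatMap fun s => (List.range 6).flatMap fun (p : ℕ) =>
    [true, false].flatMap fun t => (List.range 6).flatMap fun (q : ℕ) =>
      bif classValue k (foldIndex (dihedralIndex s p 0)) (foldIndex (dihedralIndex t q 0)) == 0 then
        [(classDenominator k, orbitRow k s p t q)] else []

/-- `c • x = d • y`. -/
def proportional (c d : ℤ) : List ℤ → List ℤ → Bool
  | [], [] => true
  | x :: xs, y :: ys => bif c * x == d * y then proportional c d xs ys else false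
  | _, _ => false

/-- Every entry is a multiple of a row, up to a denominator. -/
def matchRows (G : List RayEntry) : Bool :=
  forceList (fun r k => forceInt r.1 fun c => forceList forceInt r.2 fun l => k (c, l)) orbitRows
    -- The value on (0, 0) is zero, so the sum of the eight coordinates is 9 times the last matrix
    -- entry; comparing with a normalized row multiplied by its denominator gives these two factors.
    fun R => G.all fun e => R.any fun r => proportional (9 * r.1) e.2.sum e.2 r.2

/-- The computational core: all 27 cuts are made and every resulting ray is recognized as a multiple
of an orbit element. -/
theorem ddRun_matchRows : ddRun 27 8 initialEntries matchRows = true := by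
  decide +kernel

theorem proportional_getD {c d : ℤ} {xs ys : List ℤ} (h : proportional c d xs ys = true) (i : ℕ) :
    c * xs.getD i 0 = d * ys.getD i 0 := by
  induction xs generalizing ys i with
  | nil => cases ys with
    | nil => simp
    | cons y ys => simp [proportional] at h
  | cons x xs ih => cases ys with
    | nil => simp [proportional] at h
    | cons y ys =>
      rw [proportional, cond_eq_ite] at h
      split_ifs at h with hxy
      cases i with
      | zero => simpa using hxy
      | succ i => simpa using ih h i

/-- The `j`-th constraint as a linear functional. -/
noncomputable def constraintFunctional (j : ℕ) : Matrix (Fin 3) (Fin 3) ℝ →ₗ[ℝ] ℝ :=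
  ((effectWeight (constraintPair j).1 * effectWeight (constraintPair j).2 : ℤ) : ℝ) •
    hexValueₗ (constraintPair j).1 (constraintPair j).2

theorem constraintFunctional_eq_zero_iff (j : ℕ) (Φ : Matrix (Fin 3) (Fin 3) ℝ) :
    constraintFunctional j Φ = 0 ↔ hexValue Φ (constraintPair j).1 (constraintPair j).2 = 0 := by
  have hw : ((effectWeight (constraintPair j).1 * effectWeight (constraintPair j).2 : ℤ) : ℝ) ≠ 0 := by
    exact_mod_cast (mul_pos (effectWeight_pos _) (effectWeight_pos _)).ne'
  rw [constraintFunctional, LinearMap.smul_apply, hexValueₗ_apply, smul_eq_mul, mul_eq_zero,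
    or_iff_right hw]

theorem constraintFunctional_nonneg (j : ℕ) {Φ : Matrix (Fin 3) (Fin 3) ℝ}
    (h : ∀ i j, 0 ≤ hexValue Φ i j) : 0 ≤ constraintFunctional j Φ := by
  have hw : (0 : ℝ) ≤ (effectWeight (constraintPair j).1 * effectWeight (constraintPair j).2 : ℤ) := by
    exact_mod_cast (mul_pos (effectWeight_pos _) (effectWeight_pos _)).le
  exact mul_nonneg hw (h _ _)

theorem constraintPair_lt (j : ℕ) : (constraintPair j).1 < 6 ∧ (constraintPair j).2 < 6 := by
  rcases lt_or_ge j 43 with h | h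
  · revert j; decide
  · rw [constraintPair, List.getD_eq_default _ _ (show constraintPairs.length ≤ j from h)]; decide

theorem hexValue_vecMulVec (x y : Fin 3 → ℝ) (i j : ℤ) :
    hexValue (vecMulVec x y) i j = (hexEffect i ⬝ᵥ x) * (hexEffect j ⬝ᵥ y) := by
  simp only [hexValue, prodEffect, dotProduct, mulVec, vecMulVec_apply, Fin.sum_univ_three]; ring

theorem coordPair_lt (k : ℕ) : (coordPair k).1 < 3 ∧ (coordPair k).2 < 3 := by
  rcases lt_or_ge k 8 with h | h
  · revert k; decide
  · rw [coordPair, List.getD_eq_default _ _ (show coordPairs.length ≤ k from h)]; decide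

/-- The matrices dual to the coordinates. -/
noncomputable def coordMatrix (k : ℕ) : Matrix (Fin 3) (Fin 3) ℝ :=
  vecMulVec (dualState ⟨(coordPair k).1, (coordPair_lt k).1⟩)
    (dualState ⟨(coordPair k).2, (coordPair_lt k).2⟩)

theorem constraintFunctional_coordMatrix (j k : ℕ) :
    constraintFunctional j (coordMatrix k) = pairCoeff k (constraintPair j) := by
  have h1 := effectWeight_mul_dotProduct ⟨_, (constraintPair_lt j).1⟩ ⟨_, (coordPair_lt k).1⟩
  have h2 := effectWeight_mul_dotProduct ⟨_, (constraintPair_lt j).2⟩ ⟨_, (coordPair_lt k).2⟩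
  rw [constraintFunctional, LinearMap.smul_apply, hexValueₗ_apply, smul_eq_mul, coordMatrix,
    hexValue_vecMulVec, pairCoeff, Int.cast_mul, Int.cast_mul, ← h1, ← h2]
  ring

/-- The matrices whose value on the pair `(0, 0)` vanishes. -/
noncomputable def zeroFace : Submodule ℝ (Matrix (Fin 3) (Fin 3) ℝ) := LinearMap.ker (hexValueₗ 0 0)

theorem mem_zeroFace {Φ : Matrix (Fin 3) (Fin 3) ℝ} : Φ ∈ zeroFace ↔ hexValue Φ 0 0 = 0 :=
  LinearMap.mem_ker

theorem pairCoeff_zero {k : ℕ} (hk : k < 8) : pairCoeff k (0, 0) = 0 := by revert k; decide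

theorem exists_coordPair (a b : Fin 3) : (a, b) = (0, 0) ∨
    ∃ k < 8, constraintPair k = (2 * (a : ℕ), 2 * (b : ℕ)) := by revert a b; decide

theorem exists_constraintPair {i j : ℕ} (hi : i < 6) (hj : j < 6) : (i = 0 ∧ j = 0) ∨
    ∃ m < 35, constraintPair m = (i, j) := by
  have : ∀ i < 6, ∀ j < 6, (i = 0 ∧ j = 0) ∨ ∃ m < 35, constraintPair m = (i, j) := by
    decide +kernel
  exact this i hi j hj

/-- A nonzero vector of the zero face has a nonzero coordinate, and the ray of that coordinate
vanishes on all the others. -/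
theorem initialEntries_hitsAllFaces :
    HitsAllFaces constraintFunctional zeroFace 8 initialEntries where
  represents e he := by
    obtain ⟨k, hk, rfl⟩ := List.mem_map.1 he
    rw [List.mem_range] at hk
    refine ⟨coordMatrix k, ?_, fun j hj => ?_, ⟨k, hk, ?_⟩, fun j hj => ?_, fun i => ?_⟩
    · have h0 : constraintPair 43 = (0, 0) := by decide
      have := constraintFunctional_coordMatrix 43 k
      rw [h0, pairCoeff_zero hk, Int.cast_zero, constraintFunctional_eq_zero_iff, h0] at this
      exact mem_zeroFace.2 this
    · rw [constraintFunctional_coordMatrix]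
      have : ∀ k < 8, ∀ j < 8, 0 ≤ pairCoeff k (constraintPair j) := by decide
      exact_mod_cast this k hk j hj
    · rw [constraintFunctional_coordMatrix]
      have : ∀ k < 8, 0 < pairCoeff k (constraintPair k) := by decide
      exact_mod_cast this k hk
    · have hj8 : j < 8 := by
        by_contra! hge
        have hlt : 255 - 2 ^ k < 2 ^ j := by
          have := Nat.pow_le_pow_right (n := 2) (by norm_num) hge
          exact (Nat.sub_le _ _).trans_lt (by omega)
        rw [Nat.testBit_lt_two_pow hlt] at hj
        exact Bool.false_ne_true hj
      refine ⟨hj8, ?_⟩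
      have : ∀ k < 8, ∀ j < 8, (255 - 2 ^ k).testBit j = true →
        pairCoeff k (constraintPair j) = 0 := by decide
      rw [constraintFunctional_coordMatrix, this k hk j hj8 hj, Int.cast_zero]
    · rw [constraintFunctional_coordMatrix]
      have h1 : constraintPair (8 + i) = (cutPairs ++ evenPairs).getD i (0, 0) := by
        rw [constraintPair, constraintPairs, List.getD_append_right _ _ _ _ (by simp [evenPairs, coordPairs])]
        simp [evenPairs, coordPairs]
      rw [h1, ← pairCoeff_zero hk, List.getD_map]
  cover x hx hx0 _ := by
    obtain ⟨k, hk, hne⟩ : ∃ k < 8, constraintFunctional k x ≠ 0 := by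
      by_contra! hcon
      refine hx0 (ext_hexValue fun a b => ?_)
      have h0 : hexValue (0 : Matrix (Fin 3) (Fin 3) ℝ) (2 * a) (2 * b) = 0 := (hexValueₗ _ _).map_zero
      rw [h0]
      rcases exists_coordPair a b with h | ⟨k, hk, h⟩
      · rw [Prod.mk.injEq] at h
        rw [h.1, h.2]; exact mem_zeroFace.1 hx
      · have := hcon k hk
        rw [constraintFunctional_eq_zero_iff, h] at this
        exact_mod_cast this
    refine ⟨_, List.mem_map.2 ⟨k, List.mem_range.2 hk, rfl⟩, fun j hj hxj => ?_⟩
    have : ∀ k < 8, ∀ j < 8, j ≠ k → (255 - 2 ^ k).testBit j = true := by decide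
    exact this k hk j hj fun h => hne (h ▸ hxj)

theorem exists_of_matchRows {G : List RayEntry} (h : matchRows G = true) {e : RayEntry} (he : e ∈ G) :
    ∃ k : Fin 7, ∃ s : Bool, ∃ p : ℕ, ∃ t : Bool, ∃ q : ℕ,
      classValue k (foldIndex (dihedralIndex s p 0)) (foldIndex (dihedralIndex t q 0)) = 0 ∧
      proportional (9 * classDenominator k) e.2.sum e.2 (orbitRow k s p t q) = true := by
  rw [matchRows, forceList_eq (g := id) fun r k => by
    rw [forceInt_eq]
    exact (forceList_eq (g := id) (fun _ _ => forceInt_eq _ _) r.2 _).trans (by rw [List.map_id]; rfl),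
    List.map_id, List.all_eq_true] at h
  obtain ⟨r, hr, hp⟩ := List.any_eq_true.1 (h e he)
  simp only [orbitRows, List.mem_flatMap, List.mem_range] at hr
  obtain ⟨k, hk, s, -, p, -, t, -, q, -, hr⟩ := hr
  rw [cond_eq_ite] at hr
  split_ifs at hr with hz
  · rw [List.mem_singleton] at hr
    subst hr
    exact ⟨⟨k, hk⟩, s, p, t, q, by simpa using hz, hp⟩
  · simp at hr

theorem orbitRow_getD (k : ℕ) (s : Bool) (p : ℕ) (t : Bool) (q : ℕ) {i : ℕ} (hi : i < 8) :
    (orbitRow k s p t q).getD i 0 = classValue k (foldIndex (dihedralIndex s p (constraintPair (35 + i)).1))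
      (foldIndex (dihedralIndex t q (constraintPair (35 + i)).2)) := by
  interval_cases i <;> rfl

/-- An extreme state that vanishes on the effect pair `(0, 0)` belongs to one of seven classes. -/
theorem exists_classRep_of_hexValue_eq_zero {Φ : Matrix (Fin 3) (Fin 3) ℝ}
    (hΦ : Φ ∈ (maxTensor 6).extremePoints ℝ) (h0 : hexValue Φ 0 0 = 0) :
    ∃ k, LocallyEquivalent 6 (classRep k) Φ := by
  obtain ⟨hmax, hext⟩ := mem_extremePoints_maxTensor_iff.1 hΦ
  obtain ⟨hnn, h22⟩ := mem_maxTensor_iff.1 hmax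
  obtain ⟨G, hG, hrun⟩ := initialEntries_hitsAllFaces.ddRun 27
  have hcheck : matchRows G = true := by rw [← hrun matchRows]; exact ddRun_matchRows
  have hΦ0 : Φ ≠ 0 := by rintro rfl; simp at h22
  obtain ⟨e, he, hcov⟩ := hG.cover Φ (mem_zeroFace.2 h0) hΦ0 fun j _ =>
    constraintFunctional_nonneg j hnn
  obtain ⟨g, hg⟩ := hG.represents e he
  have hg00 : hexValue g 0 0 = 0 := mem_zeroFace.1 hg.mem
  -- The 35 constraints and the pair (0, 0) exhaust the table, so `g` vanishes wherever `Φ` does,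
  -- and extremality makes it a multiple of `Φ`.
  obtain ⟨c, hc⟩ := hext g fun i j hij => by
    have hf : ∀ i : ℤ, (foldIndex i : ℤ) = i % 6 := fun i => by unfold foldIndex; omega
    rw [hexValue_emod, ← hf, ← hf] at hij ⊢
    rcases exists_constraintPair (i := foldIndex i) (j := foldIndex j)
      (by unfold foldIndex; omega) (by unfold foldIndex; omega) with h | ⟨m, hm, h⟩
    · rw [h.1, h.2]; exact hg00
    · have hz : constraintFunctional m Φ = 0 := by
        rw [constraintFunctional_eq_zero_iff, h]; exact hij
      have := (hg.zero m (hcov m hm hz)).2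
      rwa [constraintFunctional_eq_zero_iff, h] at this
  obtain ⟨k, s, p, t, q, hz, hprop⟩ := exists_of_matchRows hcheck he
  obtain ⟨S, hS, T, hT, hv⟩ := exists_localAction_of_dihedralIndex s p t q
  have hden : (classDenominator k : ℝ) ≠ 0 := by exact_mod_cast (classDenominator_pos k).ne'
  set Ψ := localAction S T (classRep k) with hΨ
  have hval : ∀ i j : ℤ, classDenominator k * hexValue Ψ i j =
      classValue k (foldIndex (dihedralIndex s p i)) (foldIndex (dihedralIndex t q j)) := fun i j => by
    rw [hv, classDenominator_mul_hexValue]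
  have hgΨ : g = ((e.2.sum : ℝ) / 9) • Ψ := by
    refine ext_hexValue fun a b => ?_
    rw [hexValue_smul]
    refine mul_left_cancel₀ (mul_ne_zero (by norm_num : (9 : ℝ) ≠ 0) hden) ?_
    rw [show 9 * (classDenominator k : ℝ) * (e.2.sum / 9 * hexValue Ψ (2 * a) (2 * b)) =
      e.2.sum * (classDenominator k * hexValue Ψ (2 * a) (2 * b)) by ring, hval]
    rcases exists_coordPair a b with h | ⟨m, hm, h⟩
    · rw [Prod.mk.injEq] at h
      rw [h.1, h.2]
      change _ * hexValue g 0 0 = _ * ((classValue k (foldIndex (dihedralIndex s p 0)) (foldIndex (dihedralIndex t q 0)) : ℤ) : ℝ)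
      rw [hg00, hz]; simp
    · have hm' : constraintPair (35 + m) = constraintPair m := by
        have : ∀ m < 8, constraintPair (35 + m) = constraintPair m := by decide
        exact this m hm
      have hw : ∀ m < 8, effectWeight (constraintPair m).1 * effectWeight (constraintPair m).2 = 1 := by
        decide
      have h1 := hg.val m
      have h2 := proportional_getD hprop m
      rw [orbitRow_getD k s p t q hm, hm', h] at h2
      rw [constraintFunctional, LinearMap.smul_apply, hexValueₗ_apply, hm', hw m hm, h] at h1
      have h3 := congrArg (Int.cast : ℤ → ℝ) h2
      rw [Int.cast_mul, Int.cast_mul, Int.cast_mul] at h3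
      simp only [Nat.cast_mul, Nat.cast_ofNat, Int.cast_ofNat, Int.cast_one, one_smul] at h1 h3
      rw [h1]
      exact h3
  have hrep22 : Ψ 2 2 = 1 := by
    rw [hΨ, localAction_apply_two_two hS hT]
    fin_cases k <;> simp [classRep, hexPhiI, hexPhiII, hexPhiIII, hexPhiIV, hexPhiV, hexPhiVI, pureState]
  have hc22 : c = (e.2.sum : ℝ) / 9 := by
    have h1 := congrFun (congrFun hc 2) 2
    have h2 := congrFun (congrFun hgΨ 2) 2
    rw [Matrix.smul_apply, h22] at h1
    rw [Matrix.smul_apply, hrep22] at h2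
    simpa [h1] using h2
  have hc0 : c ≠ 0 := by
    rintro rfl
    obtain ⟨j, -, hj⟩ := hg.pos
    rw [hc, zero_smul, map_zero] at hj
    exact lt_irrefl _ hj
  refine ⟨k, S, hS, T, hT, ?_⟩
  rw [← hΨ]
  rw [hc, ← hc22] at hgΨ
  exact smul_right_injective _ hc0 hgΨ

/-- If no value vanished, the criterion by zeros would make every matrix a multiple of `Φ`, which a
matrix unit refutes. Rotations on the two sides move a zero at `(i, j)` to `(0, 0)`. -/
theorem exists_classRep {Φ : Matrix (Fin 3) (Fin 3) ℝ}
    (hΦ : Φ ∈ (maxTensor 6).extremePoints ℝ) : ∃ k, LocallyEquivalent 6 (classRep k) Φ := by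
  obtain ⟨i, j, hij⟩ : ∃ i j, hexValue Φ i j = 0 := by
    by_contra! hcon
    obtain ⟨c, hc⟩ := (mem_extremePoints_maxTensor_iff.1 hΦ).2 (Matrix.single 0 0 1)
      fun i j hij => absurd hij (hcon i j)
    have h22 := congrFun (congrFun hc 2) 2
    have h00 := congrFun (congrFun hc 0) 0
    rw [Matrix.smul_apply, (mem_maxTensor_iff.1 hΦ.1).2] at h22
    have hc0 : c = 0 := by simpa using h22.symm
    simp [hc0] at h00
  obtain ⟨S, hS, T, hT, hv⟩ := exists_localAction_of_dihedralIndex true i true j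
  have heq : LocallyEquivalent 6 Φ (localAction S T Φ) := ⟨S, hS, T, hT, rfl⟩
  obtain ⟨k, hk⟩ := exists_classRep_of_hexValue_eq_zero
    (mem_extremePoints_of_locallyEquivalent heq hΦ) (by
      rw [hv]; simpa [dihedralIndex] using hij)
  exact ⟨k, locallyEquivalent_equivalence.trans hk (locallyEquivalent_equivalence.symm heq)⟩

/-! ### The six classes -/

theorem classRep_last_mem_minTensor : classRep 6 ∈ minTensor 6 :=
  subset_convexHull ℝ _ ⟨_, pureState_mem_stateSpace (by norm_num) le_rfl, _,
    pureState_mem_stateSpace (by norm_num) le_rfl, rfl⟩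

theorem exists_hexPhi {Φ : Matrix (Fin 3) (Fin 3) ℝ} (hΦ : Φ ∈ extremeEntangled 6) :
    ∃ k, LocallyEquivalent 6 (hexPhi k) Φ := by
  obtain ⟨k, hk⟩ := exists_classRep hΦ.1
  induction k using Fin.lastCases with
  | last => exact absurd (mem_minTensor_of_locallyEquivalent hk classRep_last_mem_minTensor) hΦ.2
  | cast k => exact ⟨k, classRep_castSucc k ▸ hk⟩

theorem classDenominator_mul_hexValue_hexPhi (k : Fin 6) (i j : ℤ) :
    classDenominator k * hexValue (hexPhi k) i j = classValue k (foldIndex i) (foldIndex j) := by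
  rw [← classRep_castSucc]; exact classDenominator_mul_hexValue k.castSucc i j

theorem hexPhi_apply_two_two (k : Fin 6) : hexPhi k 2 2 = 1 := by
  fin_cases k <;> simp [hexPhi, hexPhiI, hexPhiII, hexPhiIII, hexPhiIV, hexPhiV, hexPhiVI]

theorem hexPhi_mem_maxTensor (k : Fin 6) : hexPhi k ∈ maxTensor 6 := by
  refine mem_maxTensor_iff.2 ⟨fun i j => ?_, hexPhi_apply_two_two k⟩
  have h1 := classDenominator_mul_hexValue_hexPhi k i j
  have h2 : (0 : ℝ) < classDenominator k := by exact_mod_cast classDenominator_pos k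
  have h3 : ∀ k : Fin 6, ∀ i j : Fin 6, 0 ≤ classValue k i j := by decide +kernel
  have h4 : (0 : ℝ) ≤ classValue k (foldIndex i) (foldIndex j) := by
    exact_mod_cast h3 k ⟨foldIndex i, by unfold foldIndex; omega⟩
      ⟨foldIndex j, by unfold foldIndex; omega⟩
  rw [← h1] at h4
  exact nonneg_of_mul_nonneg_right h4 h2

set_option maxHeartbeats 4000000 in
/-- The zeros of the table of a class determine it up to a factor. -/
theorem classTable_unique (k : Fin 6) (x : Fin 3 → Fin 3 → ℝ)
    (hx : ∀ i j : Fin 6, classValue k i j = 0 →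
      ∑ a : Fin 3, ∑ b : Fin 3, (effectCoeff i a * effectCoeff j b : ℤ) * x a b = 0) (a b : Fin 3) :
    9 * (classDenominator k * x a b) = (∑ a, ∑ b, x a b) * classValue k (2 * a) (2 * b) := by
  simp only [Fin.sum_univ_three] at hx ⊢
  -- For each class the zeros give homogeneous linear equations in the nine unknowns; they leave
  -- only the sum of the unknowns free.
  fin_cases k <;>
    simp [Fin.forall_fin_succ, classValue, classTables, effectCoeff, effectCoeffs] at hx <;>
    fin_cases a <;> fin_cases b <;>
    simp [classValue, classTables, classDenominator] <;> linarith

theorem hexPhi_mem_extremePoints (k : Fin 6) : hexPhi k ∈ (maxTensor 6).extremePoints ℝ := by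
  refine mem_extremePoints_maxTensor_iff.2 ⟨hexPhi_mem_maxTensor k, fun D hD => ⟨D 2 2, ?_⟩⟩
  have hden : (classDenominator k : ℝ) ≠ 0 := by exact_mod_cast (classDenominator_pos k).ne'
  have hf : ∀ i : Fin 6, foldIndex (i : ℤ) = i := by decide
  refine ext_hexValue fun a b => ?_
  have := classTable_unique k (fun a b => hexValue D (2 * a) (2 * b)) (fun i j hij => by
    rw [← effectWeight_mul_hexValue, hD i j, mul_zero]
    have := classDenominator_mul_hexValue_hexPhi k i j
    rw [hf, hf, hij, Int.cast_zero] at this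
    exact (mul_eq_zero.1 this).resolve_left hden) a b
  rw [← apply_two_two_eq_sum] at this
  have hv := classDenominator_mul_hexValue_hexPhi k (2 * a) (2 * b)
  have hf2 : ∀ a : Fin 3, foldIndex (2 * a : ℤ) = 2 * a := by decide
  rw [hf2, hf2] at hv
  rw [hexValue_smul]
  refine mul_left_cancel₀ (mul_ne_zero (by norm_num : (9 : ℝ) ≠ 0) hden) ?_
  rw [mul_assoc, this, ← hv]; ring

/-- If the state were separable it would be a product, and all 2 by 2 minors of its table would
vanish; the upper left one does not. -/
theorem hexPhi_mem_extremeEntangled (k : Fin 6) : hexPhi k ∈ extremeEntangled 6 := by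
  refine ⟨hexPhi_mem_extremePoints k, fun hmin => ?_⟩
  obtain ⟨a, -, b, -, hab⟩ := exists_vecMulVec_of_mem_minTensor (hexPhi_mem_extremePoints k) hmin
  have hv := classDenominator_mul_hexValue_hexPhi k
  have hminor : (classValue k 0 0 * classValue k 1 1 : ℝ) = classValue k 0 1 * classValue k 1 0 := by
    have e : ∀ i j : ℕ, i < 6 → j < 6 → (classValue k i j : ℝ) =
        classDenominator k * ((hexEffect i ⬝ᵥ a) * (hexEffect j ⬝ᵥ b)) := by
      intro i j hi hj
      rw [← hexValue_vecMulVec, ← hab, hv, show foldIndex i = i by unfold foldIndex; omega,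
        show foldIndex j = j by unfold foldIndex; omega]
    rw [e 0 0, e 1 1, e 0 1, e 1 0] <;> try norm_num
    ring
  have hne : ∀ k : Fin 6, classValue k 0 0 * classValue k 1 1 ≠ classValue k 0 1 * classValue k 1 0 := by
    decide
  exact hne k (by exact_mod_cast hminor)

/-- For each of the 144 pairs of dihedral permutations some entry differs. This also separates the
fourth and fifth classes, whose representatives are transposes of each other and so are related by
the swap. -/
theorem classTables_not_equivalent : ∀ j k : Fin 6, j ≠ k → ∀ (s : Bool) (p : Fin 6) (t : Bool)
    (q : Fin 6), ∃ x y : Fin 6, classDenominator j * classValue k x y ≠ classDenominator k *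
      classValue j (foldIndex (dihedralIndex s p x)) (foldIndex (dihedralIndex t q y)) := by
  decide +kernel

theorem eq_of_locallyEquivalent_hexPhi {j k : Fin 6}
    (h : LocallyEquivalent 6 (hexPhi j) (hexPhi k)) : j = k := by
  by_contra hjk
  obtain ⟨S, hS, T, hT, h⟩ := h
  obtain ⟨s, p, t, q, hv⟩ := exists_hexValue_localAction hS hT
  have hfold : ∀ (s : Bool) (p x : ℤ), foldIndex (dihedralIndex s (foldIndex p) x) =
      foldIndex (dihedralIndex s p x) := by
    intro s p x
    cases s <;> simp [dihedralIndex, foldIndex] <;> omega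
  obtain ⟨x, y, hxy⟩ := classTables_not_equivalent j k hjk s ⟨foldIndex p, by unfold foldIndex; omega⟩
    t ⟨foldIndex q, by unfold foldIndex; omega⟩
  apply hxy
  rw [hfold, hfold]
  have hf : ∀ i : Fin 6, foldIndex (i : ℤ) = i := by decide
  have h1 := classDenominator_mul_hexValue_hexPhi k x y
  rw [hf, hf, h, hv] at h1
  have h2 := classDenominator_mul_hexValue_hexPhi j (dihedralIndex s p x) (dihedralIndex t q y)
  have : (classDenominator j * classValue k x y : ℝ) = classDenominator k *
      classValue j (foldIndex (dihedralIndex s p x)) (foldIndex (dihedralIndex t q y)) := by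
    rw [← h1, ← h2]; ring
  exact_mod_cast this

theorem mem_extremeEntangled_iff (Φ : Matrix (Fin 3) (Fin 3) ℝ) :
    Φ ∈ extremeEntangled 6 ↔ ∃ k : Fin 6, LocallyEquivalent 6 (hexPhi k) Φ :=
  ⟨exists_hexPhi, fun ⟨k, hk⟩ =>
    mem_extremeEntangled_of_locallyEquivalent hk (hexPhi_mem_extremeEntangled k)⟩

theorem ncard_entanglementClasses : (entanglementClasses 6).ncard = 6 := by
  have hE := locallyEquivalent_equivalence
  have h : entanglementClasses 6 = Set.range fun k : Fin 6 =>
      {Ψ | Ψ ∈ extremeEntangled 6 ∧ LocallyEquivalent 6 (hexPhi k) Ψ} := by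
    ext C
    constructor
    · rintro ⟨Φ, hΦ, rfl⟩
      obtain ⟨k, hk⟩ := exists_hexPhi hΦ
      refine ⟨k, ?_⟩
      ext Ψ
      exact and_congr_right fun _ => ⟨fun h => hE.trans (hE.symm hk) h, fun h => hE.trans hk h⟩
    · rintro ⟨k, rfl⟩
      exact ⟨_, hexPhi_mem_extremeEntangled k, rfl⟩
  rw [h, ← Set.image_univ, Set.ncard_image_of_injective, Set.ncard_univ, Nat.card_eq_fintype_card,
    Fintype.card_fin]
  intro j k hjk
  have : hexPhi k ∈ {Ψ | Ψ ∈ extremeEntangled 6 ∧ LocallyEquivalent 6 (hexPhi j) Ψ} := by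
    rw [show {Ψ | Ψ ∈ extremeEntangled 6 ∧ LocallyEquivalent 6 (hexPhi j) Ψ} = _ from hjk]
    exact ⟨hexPhi_mem_extremeEntangled k, hE.refl _⟩
  exact eq_of_locallyEquivalent_hexPhi this.2

theorem isSymmetricState_of_transpose_eq {n : ℕ} {Φ : Matrix (Fin 3) (Fin 3) ℝ} (h : Φᵀ = Φ) :
    IsSymmetricState n Φ := by
  intro e _ f _
  rw [prodEffect, dotProduct_mulVec, ← mulVec_transpose, h, dotProduct_comm]; rfl

/-- The effects with indices 0 and 1 are tested in both orders. -/
theorem not_isSymmetricState_hexPhi {k : Fin 6} (h : classValue k 0 1 ≠ classValue k 1 0) :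
    ¬ IsSymmetricState 6 (hexPhi k) := by
  intro hs
  have h01 := classDenominator_mul_hexValue_hexPhi k 0 1
  have h10 := classDenominator_mul_hexValue_hexPhi k 1 0
  rw [hexValue, hs _ (hexEffect_mem_effectCone 0) _ (hexEffect_mem_effectCone 1)] at h01
  rw [hexValue, h01] at h10
  exact h (by exact_mod_cast h10)

theorem locallyEquivalent_hexPhiIII_hexPhiIII' : LocallyEquivalent 6 hexPhiIII hexPhiIII' := by
  refine ⟨1, one_mem_reversibleTransformations, planarIsometry (Real.pi * (3 : ℤ) / 3) 1,
    mem_reversibleTransformations_iff.2 ⟨3, 1, Or.inl rfl, rfl⟩, ?_⟩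
  have h : Real.pi * (3 : ℤ) / 3 = Real.pi := by push_cast; ring
  rw [h]
  ext i j
  fin_cases i <;> fin_cases j <;>
    simp [localAction, hexPhiIII, hexPhiIII', planarIsometry, Matrix.mul_apply, Fin.sum_univ_three,
      neg_div]

theorem mainTheorem4 :
    -- local reversible equivalence is an equivalence relation
    Equivalence (LocallyEquivalent 6) ∧
    -- the six representatives are extreme entangled states
    (∀ k : Fin 6, hexPhi k ∈ extremeEntangled 6) ∧
    -- no two of them are equivalent
    (∀ j k : Fin 6, LocallyEquivalent 6 (hexPhi j) (hexPhi k) → j = k) ∧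
    -- the extreme entangled states are exactly the states equivalent to one of them
    (∀ Φ : Matrix (Fin 3) (Fin 3) ℝ,
      Φ ∈ extremeEntangled 6 ↔ ∃ k : Fin 6, LocallyEquivalent 6 (hexPhi k) Φ) ∧
    -- there are exactly six classes
    (entanglementClasses 6).ncard = 6 ∧
    -- the first representative is Janotta's state
    hexPhiI = janottaState 6 ∧
    -- the second, third and sixth are symmetric, the other three are not
    IsSymmetricState 6 hexPhiII ∧ IsSymmetricState 6 hexPhiIII ∧ IsSymmetricState 6 hexPhiVI ∧
    ¬ IsSymmetricState 6 hexPhiI ∧ ¬ IsSymmetricState 6 hexPhiIV ∧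
    ¬ IsSymmetricState 6 hexPhiV ∧
    -- the sign variant of the third represents the same class
    LocallyEquivalent 6 hexPhiIII hexPhiIII' := by
  refine ⟨locallyEquivalent_equivalence, hexPhi_mem_extremeEntangled,
    fun _ _ => eq_of_locallyEquivalent_hexPhi, mem_extremeEntangled_iff,
    ncard_entanglementClasses, ?_, isSymmetricState_of_transpose_eq ?_,
    isSymmetricState_of_transpose_eq ?_, isSymmetricState_of_transpose_eq ?_,
    not_isSymmetricState_hexPhi (k := 0) (by decide),
    not_isSymmetricState_hexPhi (k := 3) (by decide),
    not_isSymmetricState_hexPhi (k := 4) (by decide), locallyEquivalent_hexPhiIII_hexPhiIII'⟩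
  · rw [janottaState, if_pos (by decide), hexPhiI]; norm_num
  all_goals
    ext i j
    fin_cases i <;> fin_cases j <;> rfl
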